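/- Let $A$ be a finite nonempty set of actions. For a finite set $\Omega$ of states, a prior $\mu_0\in\Delta\Omega$ that is interior ($\mu_0(\omega)>0$ for all $\omega$), and a finite message set $M$ with $|M|>\max\{|\Omega|,|A|\}$, consider the game between Sender and Receiver in which Sender chooses $\sigma:\Omega\to\Delta M$ and Receiver chooses $\rho:M\to\Delta A$. An environment is a pair $(u_S,u_R)$ of utility functions $A\times\Omega\to[0,1]$, so the set of environments is $[0,1]^{2|A||\Omega|}$; the share of environments with a given property is the Lebesgue measure of the set of environments that have it. A profile $(\sigma,\rho)$ induces the expected payoffs $$U_i(\sigma,\rho)=\sum_{\omega,m,a}\mu_0(\omega)\,\sigma(m|\omega)\,\rho(a|m)\,u_i(a,\omega),\qquad i=S,R.$$ The profile is S-BR if $\sigma$ maximizes $U_S(\cdot,\rho)$, and R-BR if $\rho$ maximizes $U_R(\sigma,\cdot)$. The persuasion payoff is the maximum of $U_S$ over all R-BR profiles; the cheap-talk payoff is the maximum of $U_S$ over all profiles that are both S-BR and R-BR (cheap-talk equilibria). Commitment is valuable if the persuasion payoff is strictly higher than the cheap-talk payoff; otherwise commitment has no value. (i) For every finite $\Omega$,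 every interior prior $\mu_0$ and every such $M$, the set of environments in which commitment has no value is measurable, and its share is at least $\frac{1}{|A|^{|A|}}$. (ii) As $|\Omega|\to\infty$, the share of environments in which commitment has no value converges to $\frac{1}{|A|^{|A|}}$, uniformly in the interior prior and the message set: for every $\varepsilon>0$ there is an $N$, depending only on $A$ and $\varepsilon$, such that for every finite $\Omega$ with $|\Omega|\ge N$, every interior prior $\mu_0$ on $\Omega$ and every finite $M$ with $|M|>\max\{|\Omega|,|A|\}$, the share differs from $\frac{1}{|A|^{|A|}}$ by less than $\varepsilon$. -/

import Mathlib

universe u v w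

open MeasureTheory

noncomputable section

namespace Commitment

/-- A utility function on a finite action set `A` and a finite state space `Ω`: `f ω a` is the
utility of action `a` in state `ω`. As a (measure) space this is `ℝ^(|A||Ω|)`. -/
abbrev Utility (A : Type u) (Ω : Type v) : Type (max u v) := Ω → A → ℝ

/-- A pair `(u_S, u_R)` of a Sender and a Receiver utility function. As a (measure) space this is
`ℝ^(2|A||Ω|)`, and `volume` on it is the Lebesgue measure. -/
abbrev UtilityPair (A : Type u) (Ω : Type v) : Type (max u v) := Utility A Ω × Utility A Ω

/-- The set of all environments: pairs of utility functions with values in `[0, 1]`. -/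
def environments (A : Type u) (Ω : Type v) : Set (UtilityPair A Ω) :=
  {e | ∀ ω a, e.1 ω a ∈ Set.Icc (0 : ℝ) 1 ∧ e.2 ω a ∈ Set.Icc (0 : ℝ) 1}

section

variable {A : Type u} [Fintype A] {Ω : Type v} [Fintype Ω] {M : Type w} [Fintype M]

/-- The share of environments that satisfy the property `P`: the Lebesgue measure of the set of
those environments. -/
def share (P : UtilityPair A Ω → Prop) : ℝ :=
  (volume {e | e ∈ environments A Ω ∧ P e}).toReal

/-- A messaging strategy `σ : Ω → ΔM`. -/
abbrev MessagingStrategy (Ω : Type v) (M : Type w) [Fintype M] : Type (max v w) :=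
  Ω → stdSimplex ℝ M

/-- An action strategy `ρ : M → ΔA`. -/
abbrev ActionStrategy (M : Type w) (A : Type u) [Fintype A] : Type (max u w) :=
  M → stdSimplex ℝ A

/-- The expected payoff, for the utility function `f`, that the profile `(σ, ρ)` induces under the
prior `μ₀`. -/
def expectedPayoff (μ₀ : stdSimplex ℝ Ω) (f : Utility A Ω)
    (σ : MessagingStrategy Ω M) (ρ : ActionStrategy M A) : ℝ :=
  ∑ ω, ∑ m, ∑ a, μ₀ ω * σ ω m * ρ m a * f ω a

/-- Sender's messaging strategy is a best response to Receiver's action strategy. -/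
def SenderBR (μ₀ : stdSimplex ℝ Ω) (e : UtilityPair A Ω)
    (σ : MessagingStrategy Ω M) (ρ : ActionStrategy M A) : Prop :=
  ∀ σ' : MessagingStrategy Ω M, expectedPayoff μ₀ e.1 σ' ρ ≤ expectedPayoff μ₀ e.1 σ ρ

/-- Receiver's action strategy is a best response to Sender's messaging strategy; such a profile is
a persuasion profile. -/
def ReceiverBR (μ₀ : stdSimplex ℝ Ω) (e : UtilityPair A Ω)
    (σ : MessagingStrategy Ω M) (ρ : ActionStrategy M A) : Prop :=
  ∀ ρ' : ActionStrategy M A, expectedPayoff μ₀ e.2 σ ρ' ≤ expectedPayoff μ₀ e.2 σ ρ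

/-- A cheap-talk equilibrium: both players best respond. -/
def IsCheapTalkEquilibrium (μ₀ : stdSimplex ℝ Ω) (e : UtilityPair A Ω)
    (σ : MessagingStrategy Ω M) (ρ : ActionStrategy M A) : Prop :=
  SenderBR μ₀ e σ ρ ∧ ReceiverBR μ₀ e σ ρ

/-- Sender's payoffs from persuasion profiles. -/
def persuasionPayoffs (M : Type w) [Fintype M] (μ₀ : stdSimplex ℝ Ω) (e : UtilityPair A Ω) :
    Set ℝ :=
  {x | ∃ (σ : MessagingStrategy Ω M) (ρ : ActionStrategy M A),
    ReceiverBR μ₀ e σ ρ ∧ x = expectedPayoff μ₀ e.1 σ ρ}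

/-- Sender's payoffs from cheap-talk equilibria. -/
def cheapTalkPayoffs (M : Type w) [Fintype M] (μ₀ : stdSimplex ℝ Ω) (e : UtilityPair A Ω) :
    Set ℝ :=
  {x | ∃ (σ : MessagingStrategy Ω M) (ρ : ActionStrategy M A),
    IsCheapTalkEquilibrium μ₀ e σ ρ ∧ x = expectedPayoff μ₀ e.1 σ ρ}

/-- The persuasion payoff: the maximum of Sender's payoffs from persuasion profiles. The maximum is
attained, see `isGreatest_persuasionPayoff`. -/
def persuasionPayoff (M : Type w) [Fintype M] (μ₀ : stdSimplex ℝ Ω) (e : UtilityPair A Ω) : ℝ :=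
  sSup (persuasionPayoffs M μ₀ e)

/-- The cheap-talk payoff: the maximum of Sender's payoffs from cheap-talk equilibria. The maximum
is attained, see `isGreatest_cheapTalkPayoff`. -/
def cheapTalkPayoff (M : Type w) [Fintype M] (μ₀ : stdSimplex ℝ Ω) (e : UtilityPair A Ω) : ℝ :=
  sSup (cheapTalkPayoffs M μ₀ e)

/-- Commitment is valuable if the persuasion payoff is strictly higher than the cheap-talk
payoff. -/
def CommitmentValuable (M : Type w) [Fintype M] (μ₀ : stdSimplex ℝ Ω) (e : UtilityPair A Ω) :
    Prop :=
  cheapTalkPayoff M μ₀ e < persuasionPayoff M μ₀ e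

/-- Commitment has no value if it is not valuable. -/
def CommitmentHasNoValue (M : Type w) [Fintype M] (μ₀ : stdSimplex ℝ Ω) (e : UtilityPair A Ω) :
    Prop :=
  ¬ CommitmentValuable M μ₀ e

/-! The maxima in the definitions of the two payoffs exist. -/

theorem continuous_expectedPayoff (μ₀ : stdSimplex ℝ Ω) (f : Utility A Ω) :
    Continuous fun p : MessagingStrategy Ω M × ActionStrategy M A =>
      expectedPayoff μ₀ f p.1 p.2 := by
  have h1 : ∀ ω m, Continuous fun p : MessagingStrategy Ω M × ActionStrategy M A => p.1 ω m :=
    fun ω m => (continuous_apply m).comp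
      (continuous_subtype_val.comp ((continuous_apply ω).comp continuous_fst))
  have h2 : ∀ m a, Continuous fun p : MessagingStrategy Ω M × ActionStrategy M A => p.2 m a :=
    fun m a => (continuous_apply a).comp
      (continuous_subtype_val.comp ((continuous_apply m).comp continuous_snd))
  unfold expectedPayoff
  refine continuous_finsetSum _ fun ω _ => continuous_finsetSum _ fun m _ =>
    continuous_finsetSum _ fun a _ => ?_
  exact ((continuous_const.mul (h1 ω m)).mul (h2 m a)).mul continuous_const

theorem isClosed_receiverBR (μ₀ : stdSimplex ℝ Ω) (e : UtilityPair A Ω) :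
    IsClosed {p : MessagingStrategy Ω M × ActionStrategy M A | ReceiverBR μ₀ e p.1 p.2} := by
  have h : {p : MessagingStrategy Ω M × ActionStrategy M A | ReceiverBR μ₀ e p.1 p.2} =
      ⋂ ρ' : ActionStrategy M A,
        {p | expectedPayoff μ₀ e.2 p.1 ρ' ≤ expectedPayoff μ₀ e.2 p.1 p.2} := by
    ext p; simp [ReceiverBR]
  rw [h]
  refine isClosed_iInter fun ρ' => ?_
  have hg : Continuous fun p : MessagingStrategy Ω M × ActionStrategy M A => (p.1, ρ') :=
    continuous_fst.prodMk continuous_const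
  have hf := Continuous.comp (continuous_expectedPayoff μ₀ e.2) hg
  exact isClosed_le hf (continuous_expectedPayoff μ₀ e.2)

theorem isClosed_senderBR (μ₀ : stdSimplex ℝ Ω) (e : UtilityPair A Ω) :
    IsClosed {p : MessagingStrategy Ω M × ActionStrategy M A | SenderBR μ₀ e p.1 p.2} := by
  have h : {p : MessagingStrategy Ω M × ActionStrategy M A | SenderBR μ₀ e p.1 p.2} =
      ⋂ σ' : MessagingStrategy Ω M,
        {p | expectedPayoff μ₀ e.1 σ' p.2 ≤ expectedPayoff μ₀ e.1 p.1 p.2} := by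
    ext p; simp [SenderBR]
  rw [h]
  refine isClosed_iInter fun σ' => ?_
  have hg : Continuous fun p : MessagingStrategy Ω M × ActionStrategy M A => (σ', p.2) :=
    continuous_const.prodMk continuous_snd
  have hf := Continuous.comp (continuous_expectedPayoff μ₀ e.1) hg
  exact isClosed_le hf (continuous_expectedPayoff μ₀ e.1)

theorem exists_isCheapTalkEquilibrium [Nonempty A] [Nonempty M] (μ₀ : stdSimplex ℝ Ω)
    (e : UtilityPair A Ω) :
    ∃ (σ : MessagingStrategy Ω M) (ρ : ActionStrategy M A), IsCheapTalkEquilibrium μ₀ e σ ρ := by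
  classical
  obtain ⟨b, hb⟩ := Finite.exists_max (fun a => ∑ ω, μ₀ ω * e.2 ω a)
  obtain ⟨m₀⟩ := ‹Nonempty M›
  let δ : stdSimplex ℝ A := ⟨Pi.single b 1, single_mem_stdSimplex ℝ b⟩
  let ε : stdSimplex ℝ M := ⟨Pi.single m₀ 1, single_mem_stdSimplex ℝ m₀⟩
  have hδ : ∀ a, δ a = if a = b then 1 else 0 := fun a => Pi.single_apply b 1 a
  have hε : ∀ m, ε m = if m = m₀ then 1 else 0 := fun m => Pi.single_apply m₀ 1 m
  have hc : ∀ (f : Utility A Ω) (σ : MessagingStrategy Ω M),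
      expectedPayoff μ₀ f σ (fun _ => δ) = ∑ ω, μ₀ ω * f ω b := by
    intro f σ
    unfold expectedPayoff
    refine Finset.sum_congr rfl fun ω _ => ?_
    have hs : ∑ m, σ ω m = 1 := (σ ω).2.2
    simp only [hδ, mul_ite, ite_mul, mul_one, mul_zero, zero_mul, Finset.sum_ite_eq',
      Finset.mem_univ, if_true]
    rw [← Finset.sum_mul, ← Finset.mul_sum, hs, mul_one]
  refine ⟨fun _ => ε, fun _ => δ, fun σ' => ?_, fun ρ' => ?_⟩
  · rw [hc, hc]
  · rw [hc]
    have hs : ∑ a, ρ' m₀ a = 1 := (ρ' m₀).2.2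
    calc expectedPayoff μ₀ e.2 (fun _ => ε) ρ'
        = ∑ ω, ∑ a, μ₀ ω * ρ' m₀ a * e.2 ω a := by
          unfold expectedPayoff
          refine Finset.sum_congr rfl fun ω _ => ?_
          rw [Finset.sum_comm]
          refine Finset.sum_congr rfl fun a _ => ?_
          simp only [hε, mul_ite, ite_mul, mul_one, mul_zero, zero_mul, Finset.sum_ite_eq',
            Finset.mem_univ, if_true]
      _ = ∑ a, ρ' m₀ a * ∑ ω, μ₀ ω * e.2 ω a := by
          rw [Finset.sum_comm]
          refine Finset.sum_congr rfl fun a _ => ?_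
          rw [Finset.mul_sum]
          exact Finset.sum_congr rfl fun ω _ => by ring
      _ ≤ ∑ a, ρ' m₀ a * ∑ ω, μ₀ ω * e.2 ω b :=
          Finset.sum_le_sum fun a _ => mul_le_mul_of_nonneg_left (hb a) ((ρ' m₀).2.1 a)
      _ = ∑ ω, μ₀ ω * e.2 ω b := by rw [← Finset.sum_mul, hs, one_mul]

theorem isGreatest_persuasionPayoff [Nonempty A] [Nonempty M] (μ₀ : stdSimplex ℝ Ω)
    (e : UtilityPair A Ω) :
    IsGreatest (persuasionPayoffs M μ₀ e) (persuasionPayoff M μ₀ e) := by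
  have himg : persuasionPayoffs M μ₀ e =
      (fun p : MessagingStrategy Ω M × ActionStrategy M A => expectedPayoff μ₀ e.1 p.1 p.2) ''
        {p | ReceiverBR μ₀ e p.1 p.2} := by
    ext x
    simp [persuasionPayoffs, eq_comm]
  have hcpt : IsCompact (persuasionPayoffs M μ₀ e) := by
    rw [himg]
    exact (isClosed_receiverBR μ₀ e).isCompact.image (continuous_expectedPayoff μ₀ e.1)
  obtain ⟨σ, ρ, h⟩ := exists_isCheapTalkEquilibrium (M := M) μ₀ e
  exact hcpt.isGreatest_sSup ⟨_, σ, ρ, h.2, rfl⟩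

theorem isGreatest_cheapTalkPayoff [Nonempty A] [Nonempty M] (μ₀ : stdSimplex ℝ Ω)
    (e : UtilityPair A Ω) :
    IsGreatest (cheapTalkPayoffs M μ₀ e) (cheapTalkPayoff M μ₀ e) := by
  have himg : cheapTalkPayoffs M μ₀ e =
      (fun p : MessagingStrategy Ω M × ActionStrategy M A => expectedPayoff μ₀ e.1 p.1 p.2) ''
        ({p | SenderBR μ₀ e p.1 p.2} ∩ {p | ReceiverBR μ₀ e p.1 p.2}) := by
    ext x
    simp [cheapTalkPayoffs, IsCheapTalkEquilibrium, eq_comm]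
  have hcpt : IsCompact (cheapTalkPayoffs M μ₀ e) := by
    rw [himg]
    exact ((isClosed_senderBR μ₀ e).inter (isClosed_receiverBR μ₀ e)).isCompact.image
      (continuous_expectedPayoff μ₀ e.1)
  obtain ⟨σ, ρ, h⟩ := exists_isCheapTalkEquilibrium (M := M) μ₀ e
  exact hcpt.isGreatest_sSup ⟨_, σ, ρ, h, rfl⟩

end

end Commitment

end

set_option linter.unusedSectionVars false

noncomputable section

namespace Commitment

/-! Let `f ω` be Sender's favourite action in state `ω`, unique for almost all environments. If
Receiver, told only `f ω`, is willing to follow it, Sender gets the best conceivable payoff in every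
state, in equilibrium, so commitment has no value (`commitmentHasNoValue_of_obedient`). For fixed
`f`, Receiver's optimal replies to the recommendations form a map `g : A → A`. Relabelling
Receiver's actions by a swap within each cell of `f` preserves volume and turns `g` into the
identity, so all `|A|^|A|` maps have equal volume. The weak reply sets cover the cube and the strict
ones are disjoint. Hence obedience has volume at least `1/|A|^|A|`, and strict obedience at most
that; summing over `f` gives the lower bound and half of the upper one.

For the upper bound, a converse is needed (`exists_favourite_of_commitmentHasNoValue`). For almost
all environments the optimal outcome is unique, so in an optimal equilibrium Receiver does not
randomize after messages that are sent, and Sender induces in each state the best of the actions in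
use. Suppose an action `b` is not in use, but is the favourite of both players in some state.
Recommending `b` there with small probability keeps Receiver obedient, because Receiver's other
preferences are generically strict, and Sender gains: a contradiction. So if every action has such a
state, all actions are in use, Sender gets the overall favourite everywhere, and Receiver strictly
obeys. An action lacks such a state with probability at most a power, with exponent `|Ω|`, of a
number below one that depends on `A` alone; this gives uniform convergence. -/

/-! ### Maximizing linear functionals over distributions. -/

/-- The degenerate distribution at `j`. -/
def dirac {J : Type*} [Fintype J] (j : J) : stdSimplex ℝ J := by
  classical exact ⟨Pi.single j 1, single_mem_stdSimplex ℝ j⟩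

theorem dirac_apply {J : Type*} [Fintype J] [DecidableEq J] (j k : J) :
    dirac j k = if k = j then 1 else 0 := by
  have h : dirac j = stdSimplex.vertex (S := ℝ) j := by
    unfold dirac
    congr!
  rw [h, stdSimplex.vertex_coe, Pi.single_apply]

theorem sum_dirac_mul {J : Type*} [Fintype J] (j : J) (w : J → ℝ) :
    ∑ k, dirac j k * w k = w j := by
  classical
  simp [dirac_apply]

theorem dirac_pos_iff {J : Type*} [Fintype J] (j k : J) : 0 < dirac j k ↔ k = j := by
  classical
  rw [dirac_apply]
  split_ifs with h <;> simp [h]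

theorem exists_pos_of_stdSimplex {J : Type*} [Fintype J] (s : stdSimplex ℝ J) : ∃ j, 0 < s j := by
  by_contra! h
  have h1 := stdSimplex.sum_eq_one s
  have h2 : ∑ j, s j ≤ 0 := Finset.sum_nonpos fun j _ => h j
  linarith

theorem sum_mul_eq_of_support {J : Type*} [Fintype J] (s : stdSimplex ℝ J) (w : J → ℝ) (c : ℝ)
    (h : ∀ j, 0 < s j → w j = c) : ∑ j, s j * w j = c := by
  calc ∑ j, s j * w j = ∑ j, s j * c := by
        refine Finset.sum_congr rfl fun j _ => ?_
        rcases (stdSimplex.zero_le s j).eq_or_lt with h0 | h0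
        · rw [← h0, zero_mul, zero_mul]
        · rw [h j h0]
    _ = c := by rw [← Finset.sum_mul, stdSimplex.sum_eq_one, one_mul]

theorem sum_mul_le_of_le {J : Type*} [Fintype J] (s : stdSimplex ℝ J) (w : J → ℝ) (c : ℝ)
    (h : ∀ j, w j ≤ c) : ∑ j, s j * w j ≤ c := by
  calc ∑ j, s j * w j ≤ ∑ j, s j * c :=
        Finset.sum_le_sum fun j _ => mul_le_mul_of_nonneg_left (h j) (stdSimplex.zero_le s j)
    _ = c := by rw [← Finset.sum_mul, stdSimplex.sum_eq_one, one_mul]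

/-- A family of distributions maximizes a separable linear functional iff each of them is
supported on maximizers. -/
theorem forall_sum_le_iff_support {I J : Type*} [Fintype I] [Fintype J] (w : I → J → ℝ)
    (s : I → stdSimplex ℝ J) :
    (∀ s' : I → stdSimplex ℝ J, ∑ i, ∑ j, s' i j * w i j ≤ ∑ i, ∑ j, s i j * w i j) ↔
      ∀ i j, 0 < s i j → ∀ k, w i k ≤ w i j := by
  classical
  constructor
  · intro h i j hj k
    have : Nonempty J := ⟨j⟩
    obtain ⟨l, hl⟩ := Finite.exists_max (w i)
    -- Deviate in coordinate `i` alone, to a point mass on a maximizer; the other coordinates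
    -- cancel.
    have h1 := h (Function.update s i (dirac l))
    rw [← Finset.add_sum_erase _ _ (Finset.mem_univ i),
      ← Finset.add_sum_erase Finset.univ (fun i => ∑ j, s i j * w i j) (Finset.mem_univ i)] at h1
    have h2 : ∑ x ∈ Finset.univ.erase i, ∑ j, (Function.update s i (dirac l)) x j * w x j =
        ∑ x ∈ Finset.univ.erase i, ∑ j, s x j * w x j := by
      refine Finset.sum_congr rfl fun x hx => ?_
      rw [Function.update_of_ne (Finset.ne_of_mem_erase hx)]
    rw [h2, Function.update_self, sum_dirac_mul] at h1
    have h3 : ∑ j, s i j * (w i l - w i j) ≤ 0 := by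
      simp only [mul_sub, Finset.sum_sub_distrib]
      rw [← Finset.sum_mul, stdSimplex.sum_eq_one]
      linarith
    have h4 : ∀ j ∈ Finset.univ, 0 ≤ s i j * (w i l - w i j) := fun j _ =>
      mul_nonneg (stdSimplex.zero_le _ _) (sub_nonneg.2 (hl j))
    have h5 := (Finset.single_le_sum h4 (Finset.mem_univ j)).trans h3
    have h6 : w i l - w i j ≤ 0 := by
      by_contra! hc
      exact absurd h5 (not_le.2 (mul_pos hj hc))
    linarith [hl k]
  · intro h s'
    refine Finset.sum_le_sum fun i _ => ?_
    obtain ⟨j, hj⟩ := exists_pos_of_stdSimplex (s i)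
    rw [sum_mul_eq_of_support (s i) (w i) (w i j) fun k hk =>
      le_antisymm (h i j hj k) (h i k hk j)]
    exact sum_mul_le_of_le _ _ _ (h i j hj)

/-! ### Best responses, obedience and the sufficient condition. -/

section

variable {A : Type u} [Fintype A] {Ω : Type v} [Fintype Ω] {M : Type w} [Fintype M]

/-- The payoff from action `a` after message `m`, weighted by the probability of `m`. -/
def messageValue (μ₀ : stdSimplex ℝ Ω) (f : Utility A Ω) (σ : MessagingStrategy Ω M) (m : M)
    (a : A) : ℝ :=
  ∑ ω, μ₀ ω * σ ω m * f ω a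

theorem expectedPayoff_eq_sum_messageValue (μ₀ : stdSimplex ℝ Ω) (f : Utility A Ω)
    (σ : MessagingStrategy Ω M) (ρ : ActionStrategy M A) :
    expectedPayoff μ₀ f σ ρ = ∑ m, ∑ a, ρ m a * messageValue μ₀ f σ m a := by
  unfold expectedPayoff messageValue
  rw [Finset.sum_comm]
  refine Finset.sum_congr rfl fun m _ => ?_
  rw [Finset.sum_comm]
  refine Finset.sum_congr rfl fun a _ => ?_
  rw [Finset.mul_sum]
  exact Finset.sum_congr rfl fun ω _ => by ring

/-- Values are not normalized to posteriors, so a message of probability zero gives every action the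
value zero and imposes nothing. -/
theorem receiverBR_iff (μ₀ : stdSimplex ℝ Ω) (e : UtilityPair A Ω)
    (σ : MessagingStrategy Ω M) (ρ : ActionStrategy M A) :
    ReceiverBR μ₀ e σ ρ ↔
      ∀ m a, 0 < ρ m a → ∀ c, messageValue μ₀ e.2 σ m c ≤ messageValue μ₀ e.2 σ m a := by
  rw [← forall_sum_le_iff_support]
  simp only [ReceiverBR, expectedPayoff_eq_sum_messageValue]

theorem expectedPayoff_eq_sum_state (μ₀ : stdSimplex ℝ Ω) (f : Utility A Ω)
    (σ : MessagingStrategy Ω M) (ρ : ActionStrategy M A) :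
    expectedPayoff μ₀ f σ ρ = ∑ ω, ∑ m, σ ω m * (μ₀ ω * ∑ a, ρ m a * f ω a) := by
  unfold expectedPayoff
  refine Finset.sum_congr rfl fun ω _ => Finset.sum_congr rfl fun m _ => ?_
  rw [Finset.mul_sum, Finset.mul_sum]
  exact Finset.sum_congr rfl fun a _ => by ring

/-- The payoff separates across states, and the positive prior weight of each state cancels. -/
theorem senderBR_iff (μ₀ : stdSimplex ℝ Ω) (hμ : ∀ ω, 0 < μ₀ ω) (e : UtilityPair A Ω)
    (σ : MessagingStrategy Ω M) (ρ : ActionStrategy M A) :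
    SenderBR μ₀ e σ ρ ↔
      ∀ ω m, 0 < σ ω m → ∀ m', ∑ a, ρ m' a * e.1 ω a ≤ ∑ a, ρ m a * e.1 ω a := by
  have h := forall_sum_le_iff_support (fun ω m => μ₀ ω * ∑ a, ρ m a * e.1 ω a) σ
  simp only [mul_le_mul_iff_right₀ (hμ _)] at h
  rw [← h]
  simp only [SenderBR, expectedPayoff_eq_sum_state]

theorem expectedPayoff_le_of_forall_le (μ₀ : stdSimplex ℝ Ω) (f : Utility A Ω) (c : Ω → ℝ)
    (h : ∀ ω a, f ω a ≤ c ω) (σ : MessagingStrategy Ω M) (ρ : ActionStrategy M A) :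
    expectedPayoff μ₀ f σ ρ ≤ ∑ ω, μ₀ ω * c ω := by
  rw [expectedPayoff_eq_sum_state]
  refine Finset.sum_le_sum fun ω _ => sum_mul_le_of_le _ _ _ fun m => ?_
  exact mul_le_mul_of_nonneg_left (sum_mul_le_of_le _ _ _ (h ω)) (stdSimplex.zero_le _ _)

/-- Receiver is willing to follow the recommendations of the direct strategy `τ`. -/
def Obedient (μ₀ : stdSimplex ℝ Ω) (r : Utility A Ω) (τ : Ω → stdSimplex ℝ A) : Prop :=
  ∀ a c, ∑ ω, μ₀ ω * τ ω a * r ω c ≤ ∑ ω, μ₀ ω * τ ω a * r ω a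

/-- An obedient direct strategy is implemented by a profile in which Receiver best responds. -/
theorem exists_profile_of_obedient [Nonempty A] (hM : Fintype.card A ≤ Fintype.card M)
    (μ₀ : stdSimplex ℝ Ω) (e : UtilityPair A Ω) (τ : Ω → stdSimplex ℝ A)
    (hτ : Obedient μ₀ e.2 τ) :
    ∃ (σ : MessagingStrategy Ω M) (ρ : ActionStrategy M A), ReceiverBR μ₀ e σ ρ ∧
      ∀ f : Utility A Ω, expectedPayoff μ₀ f σ ρ = ∑ ω, μ₀ ω * ∑ a, τ ω a * f ω a := by
  classical
  obtain ⟨ι⟩ := Function.Embedding.nonempty_of_card_le hM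
  let σ : MessagingStrategy Ω M := fun ω => ⟨fun m => ∑ a, if m = ι a then τ ω a else 0,
    fun m => Finset.sum_nonneg fun a _ => by
      split_ifs
      exacts [stdSimplex.zero_le _ _, le_rfl], by
      rw [Finset.sum_comm]
      simp⟩
  have hσ : ∀ ω m, σ ω m = ∑ a, if m = ι a then τ ω a else 0 := fun ω m => rfl
  have hι : ∀ a, Function.invFun ι (ι a) = a := Function.leftInverse_invFun ι.injective
  -- Messages outside the range of `ι` are never sent, so the default value of `invFun` there is
  -- harmless.
  let ρ : ActionStrategy M A := fun m => dirac (Function.invFun ι m)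
  have hv : ∀ (f : Utility A Ω) m c, messageValue μ₀ f σ m c =
      ∑ a, if m = ι a then ∑ ω, μ₀ ω * τ ω a * f ω c else 0 := by
    intro f m c
    unfold messageValue
    simp only [hσ, Finset.mul_sum, Finset.sum_mul]
    rw [Finset.sum_comm]
    refine Finset.sum_congr rfl fun a _ => ?_
    split_ifs <;> simp
  refine ⟨σ, ρ, (receiverBR_iff _ _ _ _).2 fun m a ha c => ?_, fun f => ?_⟩
  · obtain rfl := (dirac_pos_iff _ _).1 ha
    rw [hv, hv]
    refine Finset.sum_le_sum fun b _ => ?_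
    split_ifs with hb
    · rw [hb, hι]
      exact hτ b c
    · exact le_rfl
  · rw [expectedPayoff_eq_sum_messageValue]
    simp only [ρ, sum_dirac_mul, hv]
    rw [Finset.sum_comm]
    simp only [Finset.sum_ite_eq', Finset.mem_univ, if_true, hι]
    rw [Finset.sum_comm]
    refine Finset.sum_congr rfl fun ω _ => ?_
    rw [Finset.mul_sum]
    exact Finset.sum_congr rfl fun a _ => by ring

theorem payoff_le_persuasionPayoff [Nonempty A] [Nonempty M] {μ₀ : stdSimplex ℝ Ω}
    {e : UtilityPair A Ω} {σ : MessagingStrategy Ω M} {ρ : ActionStrategy M A}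
    (h : ReceiverBR μ₀ e σ ρ) : expectedPayoff μ₀ e.1 σ ρ ≤ persuasionPayoff M μ₀ e :=
  (isGreatest_persuasionPayoff μ₀ e).2 ⟨σ, ρ, h, rfl⟩

/-- The cheap-talk maximum is attained, so a single equilibrium witnesses the comparison of suprema.
-/
theorem commitmentHasNoValue_iff [Nonempty A] [Nonempty M] (μ₀ : stdSimplex ℝ Ω)
    (e : UtilityPair A Ω) :
    CommitmentHasNoValue M μ₀ e ↔ ∃ (σ : MessagingStrategy Ω M) (ρ : ActionStrategy M A),
      IsCheapTalkEquilibrium μ₀ e σ ρ ∧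
        persuasionPayoff M μ₀ e ≤ expectedPayoff μ₀ e.1 σ ρ := by
  unfold CommitmentHasNoValue CommitmentValuable
  rw [not_lt]
  constructor
  · intro h
    obtain ⟨σ, ρ, h1, h2⟩ := (isGreatest_cheapTalkPayoff (M := M) μ₀ e).1
    exact ⟨σ, ρ, h1, h2 ▸ h⟩
  · rintro ⟨σ, ρ, h1, h2⟩
    exact h2.trans ((isGreatest_cheapTalkPayoff μ₀ e).2 ⟨σ, ρ, h1, rfl⟩)

/-- Total weighted utility of action `c` over the states in which `f` recommends `a`. -/
def cellValue (μ₀ : stdSimplex ℝ Ω) (r : Utility A Ω) (f : Ω → A) (a c : A) : ℝ := by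
  classical exact ∑ ω, if f ω = a then μ₀ ω * r ω c else 0

theorem cellValue_eq [DecidableEq A] (μ₀ : stdSimplex ℝ Ω) (r : Utility A Ω) (f : Ω → A)
    (a c : A) : cellValue μ₀ r f a c = ∑ ω, if f ω = a then μ₀ ω * r ω c else 0 := by
  unfold cellValue
  congr!

theorem sum_mul_dirac_mul (μ₀ : stdSimplex ℝ Ω) (r : Utility A Ω) (f : Ω → A) (a c : A) :
    ∑ ω, μ₀ ω * dirac (f ω) a * r ω c = cellValue μ₀ r f a c := by
  classical
  rw [cellValue_eq]
  refine Finset.sum_congr rfl fun ω _ => ?_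
  rw [dirac_apply]
  simp [eq_comm]

/-- Sender's favourite actions, when Receiver follows them, leave no room for commitment. -/
theorem commitmentHasNoValue_of_obedient [Nonempty A] (hM : Fintype.card A ≤ Fintype.card M)
    (μ₀ : stdSimplex ℝ Ω) (e : UtilityPair A Ω) (f : Ω → A)
    (hS : ∀ ω c, e.1 ω c ≤ e.1 ω (f ω))
    (hR : ∀ a c, cellValue μ₀ e.2 f a c ≤ cellValue μ₀ e.2 f a a) :
    CommitmentHasNoValue M μ₀ e := by
  have : Nonempty M := Fintype.card_pos_iff.1 (Fintype.card_pos.trans_le hM)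
  have hob : Obedient μ₀ e.2 fun ω => dirac (f ω) := fun a c => by
    rw [sum_mul_dirac_mul, sum_mul_dirac_mul]
    exact hR a c
  obtain ⟨σ, ρ, h1, h2⟩ := exists_profile_of_obedient (M := M) hM μ₀ e _ hob
  have h3 : expectedPayoff μ₀ e.1 σ ρ = ∑ ω, μ₀ ω * e.1 ω (f ω) := by
    rw [h2]
    simp only [sum_dirac_mul]
  -- The same statewise bound rules out Sender's deviations and better persuasion profiles.
  refine (commitmentHasNoValue_iff μ₀ e).2 ⟨σ, ρ, ⟨fun σ' => ?_, h1⟩, ?_⟩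
  · rw [h3]
    exact expectedPayoff_le_of_forall_le μ₀ e.1 _ hS σ' ρ
  · obtain ⟨σ', ρ', -, h'⟩ := (isGreatest_persuasionPayoff (M := M) μ₀ e).1
    rw [h3, h']
    exact expectedPayoff_le_of_forall_le μ₀ e.1 _ hS σ' ρ'

end

/-! ### Tools for null sets and measurability. -/

/-- A measurable set that meets no line in direction `v` twice is null: its translates along `v`
are uncountably many disjoint sets of the same measure. -/
theorem measure_eq_zero_of_translates_disjoint {E : Type*} [AddCommGroup E] [Module ℝ E]
    [MeasurableSpace E] [MeasurableAdd E] (μ : Measure E) [SFinite μ] [μ.IsAddLeftInvariant]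
    {N : Set E} (hN : MeasurableSet N) (v : E)
    (h : ∀ e ∈ N, ∀ t : ℝ, t ≠ 0 → e + t • v ∉ N) : μ N = 0 := by
  by_contra hpos
  have hms : ∀ t : ℝ, MeasurableSet ((fun x => t • v + x) ⁻¹' N) := fun t =>
    measurable_const_add (t • v) hN
  have hdis : Pairwise (Function.onFun Disjoint fun t : ℝ => (fun x => t • v + x) ⁻¹' N) := by
    intro s t hst
    refine Set.disjoint_left.2 fun x hs ht => ?_
    refine h _ hs (t - s) (sub_ne_zero.2 hst.symm) ?_
    have hx : s • v + x + (t - s) • v = t • v + x := by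
      rw [sub_smul]; abel
    rw [hx]
    exact ht
  have hc := Measure.countable_meas_pos_of_disjoint_iUnion (μ := μ) hms hdis
  have hu : {t : ℝ | 0 < μ ((fun x => t • v + x) ⁻¹' N)} = Set.univ := by
    refine Set.eq_univ_of_forall fun t => ?_
    rw [Set.mem_ofPred_eq, measure_preimage_add]
    exact pos_iff_ne_zero.2 hpos
  rw [hu] at hc
  exact not_countable (Set.countable_univ_iff.1 hc)

/-- Compare the maxima of `F` over the two fibres through rational thresholds. For each threshold
`q`, the parameters whose fibre reaches `q` form the projection of a closed set along a compact
factor, which is closed. -/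
theorem measurableSet_forall_exists_le {E X : Type*} [TopologicalSpace E] [MeasurableSpace E]
    [OpensMeasurableSpace E] [TopologicalSpace X] [CompactSpace X] {K₁ K₂ : Set (E × X)}
    (h₁ : IsClosed K₁) (h₂ : IsClosed K₂) {F : E × X → ℝ} (hF : Continuous F) :
    MeasurableSet {e | ∀ x, (e, x) ∈ K₁ → ∃ y, (e, y) ∈ K₂ ∧ F (e, x) ≤ F (e, y)} := by
  have hproj : ∀ K : Set (E × X), IsClosed K → ∀ q : ℝ,
      MeasurableSet (Prod.fst '' (K ∩ {p | q ≤ F p})) := fun K hK q =>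
    (isClosedMap_fst_of_compactSpace _
      (hK.inter (isClosed_le continuous_const hF))).measurableSet
  have heq : {e | ∀ x, (e, x) ∈ K₁ → ∃ y, (e, y) ∈ K₂ ∧ F (e, x) ≤ F (e, y)} =
      ⋂ q : ℚ, (Prod.fst '' (K₁ ∩ {p | (q : ℝ) ≤ F p}))ᶜ ∪
        Prod.fst '' (K₂ ∩ {p | (q : ℝ) ≤ F p}) := by
    ext e
    simp only [Set.mem_ofPred_eq, Set.mem_iInter, Set.mem_union, Set.mem_compl_iff]
    constructor
    · intro h q
      by_cases hq : e ∈ Prod.fst '' (K₁ ∩ {p | (q : ℝ) ≤ F p})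
      · right
        obtain ⟨⟨e', x⟩, ⟨hx, hqx⟩, rfl⟩ := hq
        obtain ⟨y, hy, hxy⟩ := h x hx
        exact ⟨(e', y), ⟨hy, le_trans hqx hxy⟩, rfl⟩
      · exact Or.inl hq
    · intro h x hx
      by_contra! hc
      have hex : ∀ q : ℚ, (q : ℝ) ≤ F (e, x) → ∃ y, (e, y) ∈ K₂ ∧ (q : ℝ) ≤ F (e, y) := by
        intro q hq
        rcases h q with h' | ⟨⟨e', y⟩, ⟨hy, hqy⟩, rfl⟩
        · exact absurd ⟨(e, x), ⟨hx, hq⟩, rfl⟩ h'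
        · exact ⟨y, hy, hqy⟩
      have hcpt : IsCompact {y | (e, y) ∈ K₂} :=
        (h₂.preimage (by fun_prop : Continuous fun y : X => (e, y))).isCompact
      have hne : {y | (e, y) ∈ K₂}.Nonempty := by
        obtain ⟨q, hq⟩ := exists_rat_lt (F (e, x))
        obtain ⟨y, hy, -⟩ := hex q hq.le
        exact ⟨y, hy⟩
      -- If even the maximum over the second fibre is below `F (e, x)`, a rational strictly between
      -- them violates the threshold condition.
      obtain ⟨y, hy, hmax⟩ := hcpt.exists_isMaxOn hne
        (hF.comp (by fun_prop : Continuous fun y : X => (e, y))).continuousOn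
      obtain ⟨q, hq1, hq2⟩ := exists_rat_btwn (hc y hy)
      obtain ⟨z, hz, hqz⟩ := hex q hq2.le
      have := hmax hz
      simp only [Function.comp_apply, Set.mem_ofPred_eq] at this
      linarith
  rw [heq]
  exact MeasurableSet.iInter fun q => (hproj _ h₁ q).compl.union (hproj _ h₂ q)

/-! ### Measurability and generic environments. -/

section

variable {A : Type u} [Fintype A] {Ω : Type v} [Fintype Ω] {M : Type w} [Fintype M]

instance isAddLeftInvariant_volume_utilityPair :
    (volume : Measure (UtilityPair A Ω)).IsAddLeftInvariant :=
  Measure.prod.instIsAddLeftInvariant (μ := (volume : Measure (Utility A Ω)))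
    (ν := (volume : Measure (Utility A Ω)))

theorem continuous_expectedPayoff_joint (μ₀ : stdSimplex ℝ Ω) {E : Type*} [TopologicalSpace E]
    {f : E → Utility A Ω} {σ : E → MessagingStrategy Ω M} {ρ : E → ActionStrategy M A}
    (hf : Continuous f) (hσ : Continuous σ) (hρ : Continuous ρ) :
    Continuous fun p => expectedPayoff μ₀ (f p) (σ p) (ρ p) := by
  have h1 : ∀ ω m, Continuous fun p => σ p ω m := fun ω m =>
    (continuous_apply m).comp (continuous_subtype_val.comp ((continuous_apply ω).comp hσ))
  have h2 : ∀ m a, Continuous fun p => ρ p m a := fun m a =>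
    (continuous_apply a).comp (continuous_subtype_val.comp ((continuous_apply m).comp hρ))
  unfold expectedPayoff
  fun_prop

/-- Joint probability of state `ω` and action `a`. -/
def outcome (μ₀ : stdSimplex ℝ Ω) (p : MessagingStrategy Ω M × ActionStrategy M A) (ω : Ω)
    (a : A) : ℝ :=
  ∑ m, μ₀ ω * p.1 ω m * p.2 m a

theorem expectedPayoff_eq_sum_outcome (μ₀ : stdSimplex ℝ Ω) (f : Utility A Ω)
    (p : MessagingStrategy Ω M × ActionStrategy M A) :
    expectedPayoff μ₀ f p.1 p.2 = ∑ ω, ∑ a, outcome μ₀ p ω a * f ω a := by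
  unfold expectedPayoff outcome
  refine Finset.sum_congr rfl fun ω _ => ?_
  rw [Finset.sum_comm]
  exact Finset.sum_congr rfl fun a _ => (Finset.sum_mul _ _ _).symm

/-- The utility function that is `1` for action `a` in state `ω`, and `0` otherwise. -/
def unitUtility (ω : Ω) (a : A) : Utility A Ω := by
  classical exact Pi.single ω (Pi.single a 1)

theorem unitUtility_apply [DecidableEq A] [DecidableEq Ω] (ω ω' : Ω) (a a' : A) :
    unitUtility ω a ω' a' = if ω' = ω ∧ a' = a then 1 else 0 := by
  unfold unitUtility
  by_cases h : ω' = ω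
  · subst h
    simp [Pi.single_apply]
  · simp [h]

/-- The payoff is linear in the utility, and its coefficients are the outcome probabilities. -/
theorem expectedPayoff_add_smul_unit (μ₀ : stdSimplex ℝ Ω) (f : Utility A Ω) (t : ℝ) (ω : Ω)
    (a : A) (p : MessagingStrategy Ω M × ActionStrategy M A) :
    expectedPayoff μ₀ (f + t • unitUtility ω a) p.1 p.2 =
      expectedPayoff μ₀ f p.1 p.2 + t * outcome μ₀ p ω a := by
  classical
  have h : ∑ ω', ∑ a', outcome μ₀ p ω' a' * unitUtility ω a ω' a' = outcome μ₀ p ω a := by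
    rw [Finset.sum_eq_single ω, Finset.sum_eq_single a]
    · simp [unitUtility_apply]
    · intro a' _ ha
      simp [unitUtility_apply, ha]
    · simp
    · intro ω' _ hω
      simp [unitUtility_apply, hω]
    · simp
  simp only [expectedPayoff_eq_sum_outcome]
  rw [← h, Finset.mul_sum, ← Finset.sum_add_distrib]
  refine Finset.sum_congr rfl fun ω' _ => ?_
  rw [Finset.mul_sum, ← Finset.sum_add_distrib]
  refine Finset.sum_congr rfl fun a' _ => ?_
  simp only [Pi.add_apply, Pi.smul_apply, smul_eq_mul]
  ring

theorem isClosed_receiverBR_joint (μ₀ : stdSimplex ℝ Ω) :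
    IsClosed {q : UtilityPair A Ω × (MessagingStrategy Ω M × ActionStrategy M A) |
      ReceiverBR μ₀ q.1 q.2.1 q.2.2} := by
  simp only [ReceiverBR, Set.ofPred_forall]
  exact isClosed_iInter fun ρ' => isClosed_le
    (continuous_expectedPayoff_joint μ₀ (by fun_prop) (by fun_prop) (by fun_prop))
    (continuous_expectedPayoff_joint μ₀ (by fun_prop) (by fun_prop) (by fun_prop))

theorem isClosed_senderBR_joint (μ₀ : stdSimplex ℝ Ω) :
    IsClosed {q : UtilityPair A Ω × (MessagingStrategy Ω M × ActionStrategy M A) |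
      SenderBR μ₀ q.1 q.2.1 q.2.2} := by
  simp only [SenderBR, Set.ofPred_forall]
  exact isClosed_iInter fun ρ' => isClosed_le
    (continuous_expectedPayoff_joint μ₀ (by fun_prop) (by fun_prop) (by fun_prop))
    (continuous_expectedPayoff_joint μ₀ (by fun_prop) (by fun_prop) (by fun_prop))

theorem continuous_senderPayoff (μ₀ : stdSimplex ℝ Ω) :
    Continuous fun q : UtilityPair A Ω × (MessagingStrategy Ω M × ActionStrategy M A) =>
      expectedPayoff μ₀ q.1.1 q.2.1 q.2.2 :=
  continuous_expectedPayoff_joint μ₀ (by fun_prop) (by fun_prop) (by fun_prop)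

theorem continuous_outcome (μ₀ : stdSimplex ℝ Ω) (ω : Ω) (a : A) :
    Continuous fun p : MessagingStrategy Ω M × ActionStrategy M A => outcome μ₀ p ω a := by
  have h1 : ∀ ω m, Continuous fun p : MessagingStrategy Ω M × ActionStrategy M A => p.1 ω m :=
    fun ω m => (continuous_apply m).comp
      (continuous_subtype_val.comp ((continuous_apply ω).comp continuous_fst))
  have h2 : ∀ m a, Continuous fun p : MessagingStrategy Ω M × ActionStrategy M A => p.2 m a :=
    fun m a => (continuous_apply a).comp
      (continuous_subtype_val.comp ((continuous_apply m).comp continuous_snd))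
  unfold outcome
  fun_prop

theorem measurableSet_environments : MeasurableSet (environments A Ω) := by
  have h : IsClosed (environments A Ω) := by
    simp only [environments, Set.mem_Icc, Set.ofPred_forall, Set.ofPred_and]
    refine isClosed_iInter fun ω => isClosed_iInter fun a => ?_
    refine ((isClosed_le ?_ ?_).inter (isClosed_le ?_ ?_)).inter
      ((isClosed_le ?_ ?_).inter (isClosed_le ?_ ?_)) <;> fun_prop
  exact h.measurableSet

/-- No value means that every persuasion profile is matched by some equilibrium; both kinds of
profile form closed sets jointly with the environment. -/
theorem measurableSet_commitmentHasNoValue [Nonempty A] [Nonempty M] (μ₀ : stdSimplex ℝ Ω) :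
    MeasurableSet {e : UtilityPair A Ω | CommitmentHasNoValue M μ₀ e} := by
  have h := measurableSet_forall_exists_le (isClosed_receiverBR_joint (A := A) (M := M) μ₀)
    ((isClosed_senderBR_joint μ₀).inter (isClosed_receiverBR_joint μ₀))
    (continuous_senderPayoff μ₀)
  convert h using 1
  ext e
  rw [Set.mem_ofPred_eq, commitmentHasNoValue_iff]
  constructor
  · rintro ⟨σ, ρ, h1, h2⟩ p hp
    exact ⟨(σ, ρ), h1, (payoff_le_persuasionPayoff hp).trans h2⟩
  · intro h'
    obtain ⟨σ, ρ, h1, h2⟩ := (isGreatest_persuasionPayoff (M := M) μ₀ e).1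
    obtain ⟨⟨σ', ρ'⟩, h3, h4⟩ := h' (σ, ρ) h1
    exact ⟨σ', ρ', h3, h2 ▸ h4⟩

/-- The profile is optimal for Sender under commitment. -/
def IsOptimal (μ₀ : stdSimplex ℝ Ω) (e : UtilityPair A Ω)
    (p : MessagingStrategy Ω M × ActionStrategy M A) : Prop :=
  ReceiverBR μ₀ e p.1 p.2 ∧ ∀ q : MessagingStrategy Ω M × ActionStrategy M A,
    ReceiverBR μ₀ e q.1 q.2 → expectedPayoff μ₀ e.1 q.1 q.2 ≤ expectedPayoff μ₀ e.1 p.1 p.2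

/-- A closed condition on profiles is met by some optimal profile in a measurable set of
environments. -/
theorem measurableSet_exists_isOptimal [Nonempty A] [Nonempty M] (μ₀ : stdSimplex ℝ Ω)
    {C : Set (MessagingStrategy Ω M × ActionStrategy M A)} (hC : IsClosed C) :
    MeasurableSet {e : UtilityPair A Ω | ∃ p ∈ C, IsOptimal μ₀ e p} := by
  have h := measurableSet_forall_exists_le (isClosed_receiverBR_joint (A := A) (M := M) μ₀)
    ((isClosed_receiverBR_joint μ₀).inter (hC.preimage continuous_snd))
    (continuous_senderPayoff μ₀)
  convert h using 1
  ext e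
  constructor
  · rintro ⟨p, hpC, hp⟩ q hq
    exact ⟨p, ⟨hp.1, hpC⟩, hp.2 q hq⟩
  · intro h'
    obtain ⟨σ, ρ, h1, h2⟩ := (isGreatest_persuasionPayoff (M := M) μ₀ e).1
    obtain ⟨p, ⟨h3, h3'⟩, h4⟩ := h' (σ, ρ) h1
    exact ⟨p, h3', h3, fun q hq => ((payoff_le_persuasionPayoff hq).trans h2.le).trans h4⟩

/-- For almost all environments, all optimal profiles have the same outcome. -/
theorem ae_outcome_eq_of_isOptimal [Nonempty A] [Nonempty M] (μ₀ : stdSimplex ℝ Ω) :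
    ∀ᵐ e : UtilityPair A Ω, ∀ (p q : MessagingStrategy Ω M × ActionStrategy M A),
      IsOptimal μ₀ e p → IsOptimal μ₀ e q → ∀ ω a, outcome μ₀ p ω a = outcome μ₀ q ω a := by
  -- Two different outcome probabilities are separated by a pair of rationals, so countably many
  -- null sets suffice.
  have hnull : ∀ (ω : Ω) (a : A) (r : ℚ × ℚ), ∀ᵐ e : UtilityPair A Ω, r.1 < r.2 →
      ¬ ((∃ p ∈ {p : MessagingStrategy Ω M × ActionStrategy M A | outcome μ₀ p ω a ≤ r.1},
          IsOptimal μ₀ e p) ∧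
        ∃ p ∈ {p : MessagingStrategy Ω M × ActionStrategy M A | (r.2 : ℝ) ≤ outcome μ₀ p ω a},
          IsOptimal μ₀ e p) := by
    intro ω a r
    by_cases hr : r.1 < r.2
    swap
    · exact Filter.Eventually.of_forall fun e h => absurd h hr
    have hr' : (r.1 : ℝ) < r.2 := by exact_mod_cast hr
    have hm : MeasurableSet {e : UtilityPair A Ω |
        (∃ p ∈ {p : MessagingStrategy Ω M × ActionStrategy M A | outcome μ₀ p ω a ≤ r.1},
          IsOptimal μ₀ e p) ∧
        ∃ p ∈ {p : MessagingStrategy Ω M × ActionStrategy M A | (r.2 : ℝ) ≤ outcome μ₀ p ω a},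
          IsOptimal μ₀ e p} :=
      (measurableSet_exists_isOptimal μ₀
        (isClosed_le (continuous_outcome μ₀ ω a) continuous_const)).inter
      (measurableSet_exists_isOptimal μ₀
        (isClosed_le continuous_const (continuous_outcome μ₀ ω a)))
    have h0 := measure_eq_zero_of_translates_disjoint (volume : Measure (UtilityPair A Ω)) hm
      (unitUtility ω a, 0) ?_
    · filter_upwards [measure_eq_zero_iff_ae_notMem.1 h0] with e he _
      exact he
    rintro e ⟨⟨p, hp, hpo⟩, q, hq, hqo⟩ t ht ⟨⟨p', hp', hpo'⟩, q', hq', hqo'⟩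
    -- Tilting only Sender's utility leaves the persuasion profiles unchanged. The optimal payoff is
    -- then a maximum of functions affine in `t`, whose slopes are outcome probabilities. Optimal
    -- slopes are monotone in `t`, so they straddle the gap between `r.1` and `r.2` for at most one
    -- `t`.
    have hbr : ∀ x : MessagingStrategy Ω M × ActionStrategy M A,
        ReceiverBR μ₀ (e + t • (unitUtility ω a, (0 : Utility A Ω))) x.1 x.2 ↔
          ReceiverBR μ₀ e x.1 x.2 := by
      intro x
      simp [ReceiverBR]
    have hpay : ∀ x : MessagingStrategy Ω M × ActionStrategy M A,
        expectedPayoff μ₀ (e + t • (unitUtility ω a, (0 : Utility A Ω))).1 x.1 x.2 =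
          expectedPayoff μ₀ e.1 x.1 x.2 + t * outcome μ₀ x ω a :=
      fun x => expectedPayoff_add_smul_unit μ₀ e.1 t ω a x
    simp only [Set.mem_ofPred_eq] at hp hq hp' hq'
    have k1 := hpo.2 q' ((hbr _).1 hqo'.1)
    have k2 := hqo'.2 p ((hbr _).2 hpo.1)
    have k3 := hqo.2 p' ((hbr _).1 hpo'.1)
    have k4 := hpo'.2 q ((hbr _).2 hqo.1)
    rw [hpay, hpay] at k2 k4
    rcases lt_or_gt_of_ne ht with ht | ht
    · nlinarith
    · nlinarith
  have hall : ∀ᵐ e : UtilityPair A Ω, ∀ (ω : Ω) (a : A) (r : ℚ × ℚ), r.1 < r.2 →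
      ¬ ((∃ p ∈ {p : MessagingStrategy Ω M × ActionStrategy M A | outcome μ₀ p ω a ≤ r.1},
          IsOptimal μ₀ e p) ∧
        ∃ p ∈ {p : MessagingStrategy Ω M × ActionStrategy M A | (r.2 : ℝ) ≤ outcome μ₀ p ω a},
          IsOptimal μ₀ e p) :=
    ae_all_iff.2 fun ω => ae_all_iff.2 fun a => ae_all_iff.2 fun r => hnull ω a r
  filter_upwards [hall] with e he
  have hle : ∀ (p q : MessagingStrategy Ω M × ActionStrategy M A),
      IsOptimal μ₀ e p → IsOptimal μ₀ e q → ∀ ω a, outcome μ₀ q ω a ≤ outcome μ₀ p ω a := by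
    intro p q hp hq ω a
    by_contra! hlt
    obtain ⟨r, hr1, hr2⟩ := exists_rat_btwn hlt
    obtain ⟨r', hr1', hr2'⟩ := exists_rat_btwn hr2
    exact he ω a (r, r') (by exact_mod_cast hr1') ⟨⟨p, hr1.le, hp⟩, q, hr2'.le, hq⟩
  exact fun p q hp hq ω a => le_antisymm (hle q p hq hp ω a) (hle p q hp hq ω a)

/-- For almost all environments, Sender is not indifferent between any two actions. -/
theorem ae_sender_strict : ∀ᵐ e : UtilityPair A Ω, ∀ ω a b, a ≠ b → e.1 ω a ≠ e.1 ω b := by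
  classical
  refine ae_all_iff.2 fun ω => ae_all_iff.2 fun a => ae_all_iff.2 fun b => ?_
  by_cases hab : a = b
  · exact Filter.Eventually.of_forall fun e h => absurd hab h
  have hm : MeasurableSet {e : UtilityPair A Ω | e.1 ω a = e.1 ω b} :=
    (isClosed_eq (by fun_prop) (by fun_prop)).measurableSet
  have h0 := measure_eq_zero_of_translates_disjoint (volume : Measure (UtilityPair A Ω)) hm
    (unitUtility ω a, 0) ?_
  · filter_upwards [measure_eq_zero_iff_ae_notMem.1 h0] with e he _
    exact he
  intro e he t ht h
  simp only [Set.mem_ofPred_eq] at he h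
  simp [unitUtility_apply, Ne.symm hab, he, ht] at h

/-- For almost all environments, Receiver is not indifferent between any two actions after a
message that is sent exactly in a nonempty set of states. -/
theorem ae_receiver_strict (μ₀ : stdSimplex ℝ Ω) (hμ : ∀ ω, 0 < μ₀ ω) :
    ∀ᵐ e : UtilityPair A Ω, ∀ (f : Ω → A) (ω : Ω) (b c : A), b ≠ c →
      cellValue μ₀ e.2 f (f ω) b ≠ cellValue μ₀ e.2 f (f ω) c := by
  classical
  have hfun : ∀ f : Ω → A, ∀ᵐ e : UtilityPair A Ω, ∀ (ω : Ω) (b c : A), b ≠ c →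
      cellValue μ₀ e.2 f (f ω) b ≠ cellValue μ₀ e.2 f (f ω) c := by
    intro f
    refine ae_all_iff.2 fun ω => ae_all_iff.2 fun b => ae_all_iff.2 fun c => ?_
    by_cases hbc : b = c
    · exact Filter.Eventually.of_forall fun e h => absurd hbc h
    have hcont : ∀ c, Continuous fun e : UtilityPair A Ω => cellValue μ₀ e.2 f (f ω) c := by
      intro c
      simp only [cellValue_eq]
      refine continuous_finsetSum _ fun ω' _ => ?_
      split_ifs <;> fun_prop
    have hm : MeasurableSet {e : UtilityPair A Ω |
        cellValue μ₀ e.2 f (f ω) b = cellValue μ₀ e.2 f (f ω) c} :=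
      (isClosed_eq (hcont b) (hcont c)).measurableSet
    have h0 := measure_eq_zero_of_translates_disjoint (volume : Measure (UtilityPair A Ω)) hm
      -- State `ω` lies in the cell of `f ω`, so moving along this direction changes the value of
      -- `b` there at the nonzero rate `μ₀ ω` and leaves that of `c` fixed.
      (0, unitUtility ω b) ?_
    · filter_upwards [measure_eq_zero_iff_ae_notMem.1 h0] with e he _
      exact he
    intro e he t ht h
    simp only [Set.mem_ofPred_eq] at he h
    have hadd : ∀ d, cellValue μ₀ (e + t • ((0 : Utility A Ω), unitUtility ω b)).2 f (f ω) d =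
        cellValue μ₀ e.2 f (f ω) d + if d = b then μ₀ ω * t else 0 := by
      intro d
      have hsingle : (if d = b then μ₀ ω * t else 0) =
          ∑ ω', if ω' = ω then (if d = b then μ₀ ω * t else 0) else 0 := by simp
      rw [cellValue_eq, cellValue_eq, hsingle, ← Finset.sum_add_distrib]
      refine Finset.sum_congr rfl fun ω' _ => ?_
      by_cases h1 : ω' = ω
      · subst h1
        by_cases h2 : d = b <;> simp [unitUtility_apply, h2, mul_add]
      · simp [unitUtility_apply, h1]
    rw [hadd, hadd, if_pos rfl, if_neg (Ne.symm hbc), he] at h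
    have := mul_ne_zero (hμ ω).ne' ht
    exact this (by linarith)
  have := ae_all_iff.2 hfun
  filter_upwards [this] with e he
  exact he

end

/-! ### The necessary condition in generic environments. -/

section

variable {A : Type u} [Fintype A] {Ω : Type v} [Fintype Ω] {M : Type w} [Fintype M]

theorem expectedPayoff_update (μ₀ : stdSimplex ℝ Ω) (f : Utility A Ω)
    (σ : MessagingStrategy Ω M) (ρ : ActionStrategy M A) [DecidableEq M] (m : M) (a : A) :
    expectedPayoff μ₀ f σ (Function.update ρ m (dirac a)) =
      expectedPayoff μ₀ f σ ρ +
        (messageValue μ₀ f σ m a - ∑ c, ρ m c * messageValue μ₀ f σ m c) := by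
  rw [expectedPayoff_eq_sum_messageValue, expectedPayoff_eq_sum_messageValue,
    ← Finset.add_sum_erase _ _ (Finset.mem_univ m),
    ← Finset.add_sum_erase Finset.univ (fun m => ∑ a, ρ m a * messageValue μ₀ f σ m a)
      (Finset.mem_univ m), Function.update_self, sum_dirac_mul]
  have h : ∑ x ∈ Finset.univ.erase m, ∑ c, (Function.update ρ m (dirac a)) x c *
      messageValue μ₀ f σ x c = ∑ x ∈ Finset.univ.erase m, ∑ c, ρ x c *
      messageValue μ₀ f σ x c := by
    refine Finset.sum_congr rfl fun x hx => ?_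
    rw [Function.update_of_ne (Finset.ne_of_mem_erase hx)]
  rw [h]
  ring

/-- If optimal profiles all have the same outcome, Receiver does not randomize after messages
that are sent with positive probability. -/
theorem action_unique_of_isOptimal {μ₀ : stdSimplex ℝ Ω} (hμ : ∀ ω, 0 < μ₀ ω)
    {e : UtilityPair A Ω}
    (huniq : ∀ (p q : MessagingStrategy Ω M × ActionStrategy M A),
      IsOptimal μ₀ e p → IsOptimal μ₀ e q → ∀ ω a, outcome μ₀ p ω a = outcome μ₀ q ω a)
    {σ : MessagingStrategy Ω M} {ρ : ActionStrategy M A} (hopt : IsOptimal μ₀ e (σ, ρ))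
    {ω : Ω} {m : M} (hm : 0 < σ ω m) {a b : A} (ha : 0 < ρ m a) (hb : 0 < ρ m b) : a = b := by
  classical
  by_contra hab
  have hR := (receiverBR_iff μ₀ e σ ρ).1 hopt.1
  have hBR : ∀ c, 0 < ρ m c → ReceiverBR μ₀ e σ (Function.update ρ m (dirac c)) := by
    intro c hc
    rw [receiverBR_iff]
    intro m' d hd
    by_cases hmm : m' = m
    · subst hmm
      rw [Function.update_self, dirac_pos_iff] at hd
      subst hd
      exact hR m' d hc
    · rw [Function.update_of_ne hmm] at hd
      exact hR m' d hd
  have hle : ∀ c, 0 < ρ m c →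
      messageValue μ₀ e.1 σ m c ≤ ∑ d, ρ m d * messageValue μ₀ e.1 σ m d := by
    intro c hc
    have h := hopt.2 (σ, Function.update ρ m (dirac c)) (hBR c hc)
    simp only [expectedPayoff_update] at h
    linarith
  -- No action in the support beats the average for Sender, so all of them equal it. Each pure reply
  -- is then optimal too, yet two of them yield different outcomes.
  have heq : ∀ c, 0 < ρ m c →
      messageValue μ₀ e.1 σ m c = ∑ d, ρ m d * messageValue μ₀ e.1 σ m d := by
    intro c hc
    set s := ∑ d, ρ m d * messageValue μ₀ e.1 σ m d with hs
    have h0 : ∑ d, ρ m d * (s - messageValue μ₀ e.1 σ m d) = 0 := by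
      simp only [mul_sub, Finset.sum_sub_distrib]
      rw [← Finset.sum_mul, stdSimplex.sum_eq_one, one_mul, ← hs, sub_self]
    have hnn : ∀ d ∈ Finset.univ, 0 ≤ ρ m d * (s - messageValue μ₀ e.1 σ m d) := by
      intro d _
      rcases (stdSimplex.zero_le (ρ m) d).eq_or_lt with hd | hd
      · rw [← hd, zero_mul]
      · exact mul_nonneg hd.le (sub_nonneg.2 (hle d hd))
    have h1 := (Finset.sum_eq_zero_iff_of_nonneg hnn).1 h0 c (Finset.mem_univ c)
    rcases mul_eq_zero.1 h1 with h2 | h2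
    · exact absurd h2 hc.ne'
    · linarith
  have hoptc : ∀ c, 0 < ρ m c → IsOptimal μ₀ e (σ, Function.update ρ m (dirac c)) := by
    intro c hc
    refine ⟨hBR c hc, fun q hq => ?_⟩
    simp only [expectedPayoff_update, heq c hc, sub_self, add_zero]
    exact hopt.2 q hq
  have hout := huniq _ _ (hoptc a ha) (hoptc b hb) ω a
  have hdiff : ∀ c, outcome μ₀ (σ, Function.update ρ m (dirac c)) ω a =
      μ₀ ω * σ ω m * (dirac c a) +
        ∑ x ∈ Finset.univ.erase m, μ₀ ω * σ ω x * ρ x a := by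
    intro c
    unfold outcome
    rw [← Finset.add_sum_erase _ _ (Finset.mem_univ m)]
    dsimp only
    rw [Function.update_self]
    congr 1
    refine Finset.sum_congr rfl fun x hx => ?_
    simp only [Function.update_of_ne (Finset.ne_of_mem_erase hx)]
  rw [hdiff, hdiff, dirac_apply, dirac_apply, if_pos rfl, if_neg hab] at hout
  have := mul_pos (hμ ω) hm
  linarith

/-- The recommendation rule `f`, modified so that in state `ω₀` the action `b` is recommended with
probability `ε`. -/
def perturbedRule (f : Ω → A) (ω₀ : Ω) (b : A) (ε : ℝ) (h0 : 0 ≤ ε) (h1 : ε ≤ 1) :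
    Ω → stdSimplex ℝ A := by
  classical
  exact fun ω => if ω = ω₀ then
    ⟨fun a => (1 - ε) * dirac (f ω₀) a + ε * dirac b a,
      fun a => add_nonneg (mul_nonneg (by linarith) (stdSimplex.zero_le _ _))
        (mul_nonneg h0 (stdSimplex.zero_le _ _)),
      by rw [Finset.sum_add_distrib, ← Finset.mul_sum, ← Finset.mul_sum,
          stdSimplex.sum_eq_one, stdSimplex.sum_eq_one]; ring⟩
    else dirac (f ω)

theorem perturbedRule_apply [DecidableEq Ω] (f : Ω → A) (ω₀ : Ω) (b : A) (ε : ℝ) (h0 : 0 ≤ ε)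
    (h1 : ε ≤ 1) (ω : Ω) (a : A) :
    perturbedRule f ω₀ b ε h0 h1 ω a =
      dirac (f ω) a + if ω = ω₀ then ε * (dirac b a - dirac (f ω₀) a) else 0 := by
  by_cases h : ω = ω₀
  · subst h
    have h2 : perturbedRule f ω b ε h0 h1 ω a = (1 - ε) * dirac (f ω) a + ε * dirac b a :=
      congrArg (fun s : stdSimplex ℝ A => s a) (if_pos rfl)
    rw [h2, if_pos rfl]
    ring
  · have h2 : perturbedRule f ω₀ b ε h0 h1 ω = dirac (f ω) := if_neg h
    rw [h2, if_neg h, add_zero]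

theorem sum_perturbedRule (μ₀ : stdSimplex ℝ Ω) (r : Utility A Ω) (f : Ω → A) (ω₀ : Ω) (b : A)
    (ε : ℝ) (h0 : 0 ≤ ε) (h1 : ε ≤ 1) (a c : A) :
    ∑ ω, μ₀ ω * perturbedRule f ω₀ b ε h0 h1 ω a * r ω c =
      cellValue μ₀ r f a c + ε * (μ₀ ω₀ * r ω₀ c * (dirac b a - dirac (f ω₀) a)) := by
  classical
  have h : ε * (μ₀ ω₀ * r ω₀ c * (dirac b a - dirac (f ω₀) a)) =
      ∑ ω, if ω = ω₀ then ε * (μ₀ ω₀ * r ω₀ c * (dirac b a - dirac (f ω₀) a)) else 0 := by simp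
  rw [← sum_mul_dirac_mul, h, ← Finset.sum_add_distrib]
  refine Finset.sum_congr rfl fun ω _ => ?_
  rw [perturbedRule_apply]
  split_ifs with hω
  · rw [hω]; ring
  · ring

/-- The new recommendation `b` comes from `ω₀` alone, where Receiver likes `b` best. The
recommendation `f ω₀` loses a little mass, which its strict slack absorbs for small `ε`. All others
are unaffected. -/
theorem exists_perturbedRule_obedient {μ₀ : stdSimplex ℝ Ω} {r : Utility A Ω} {f : Ω → A}
    (hstrict : ∀ ω c, c ≠ f ω → cellValue μ₀ r f (f ω) c < cellValue μ₀ r f (f ω) (f ω))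
    {ω₀ : Ω} {b : A} (hb : b ∉ Set.range f) (hfav : ∀ c, r ω₀ c ≤ r ω₀ b) :
    ∃ (ε : ℝ) (h0 : 0 ≤ ε) (h1 : ε ≤ 1), 0 < ε ∧
      Obedient μ₀ r (perturbedRule f ω₀ b ε h0 h1) := by
  classical
  have hev : ∀ c, ∀ᶠ ε : ℝ in nhdsWithin 0 (Set.Ioi 0),
      cellValue μ₀ r f (f ω₀) c + ε * (-(μ₀ ω₀ * r ω₀ c)) ≤
        cellValue μ₀ r f (f ω₀) (f ω₀) + ε * (-(μ₀ ω₀ * r ω₀ (f ω₀))) := by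
    intro c
    by_cases hc : c = f ω₀
    · rw [hc]
      exact Filter.Eventually.of_forall fun _ => le_rfl
    · have hcont : ∀ d, Filter.Tendsto
          (fun ε : ℝ => cellValue μ₀ r f (f ω₀) d + ε * (-(μ₀ ω₀ * r ω₀ d)))
          (nhdsWithin 0 (Set.Ioi 0)) (nhds (cellValue μ₀ r f (f ω₀) d)) := by
        intro d
        have h : Continuous fun ε : ℝ =>
          cellValue μ₀ r f (f ω₀) d + ε * (-(μ₀ ω₀ * r ω₀ d)) := by fun_prop
        have := h.tendsto 0
        simp only [zero_mul, add_zero] at this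
        exact this.mono_left nhdsWithin_le_nhds
      exact ((hcont c).eventually_lt (hcont _) (hstrict ω₀ c hc)).mono fun _ h => h.le
  have hone : ∀ᶠ ε : ℝ in nhdsWithin 0 (Set.Ioi 0), ε ≤ 1 :=
    nhdsWithin_le_nhds (eventually_le_nhds zero_lt_one)
  obtain ⟨ε, ⟨hε, hε1⟩, hε0⟩ :=
    (((Filter.eventually_all.2 hev).and hone).and self_mem_nhdsWithin).exists
  have hpos : 0 < ε := hε0
  refine ⟨ε, hpos.le, hε1, hpos, fun a c => ?_⟩
  rw [sum_perturbedRule, sum_perturbedRule, dirac_apply, dirac_apply]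
  have hbf : b ≠ f ω₀ := fun h => hb ⟨ω₀, h.symm⟩
  by_cases hab : a = b
  · subst hab
    have hempty : ∀ d, cellValue μ₀ r f a d = 0 := by
      intro d
      rw [cellValue_eq]
      refine Finset.sum_eq_zero fun ω _ => if_neg fun h => hb ⟨ω, h⟩
    rw [hempty, hempty, if_pos rfl, if_neg hbf]
    have := mul_le_mul_of_nonneg_left (hfav c) (stdSimplex.zero_le μ₀ ω₀)
    have := mul_le_mul_of_nonneg_left this hpos.le
    linarith
  · rw [if_neg hab]
    by_cases haf : a = f ω₀
    · rw [if_pos haf, haf]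
      have := hε c
      linarith
    · rw [if_neg haf]
      simp only [sub_self, mul_zero, add_zero]
      by_cases har : a ∈ Set.range f
      · obtain ⟨ω, rfl⟩ := har
        by_cases hc : c = f ω
        · rw [hc]
        · exact (hstrict ω c hc).le
      · rw [cellValue_eq, cellValue_eq]
        refine Finset.sum_le_sum fun ω _ => ?_
        rw [if_neg fun h => har ⟨ω, h⟩, if_neg fun h => har ⟨ω, h⟩]

/-- In a generic environment in which every action is, in some state, the favourite of both
players, commitment has no value only if Receiver strictly prefers to follow the recommendation of
Sender's favourite action. -/
theorem exists_favourite_of_commitmentHasNoValue [Nonempty A]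
    (hM : Fintype.card A ≤ Fintype.card M) {μ₀ : stdSimplex ℝ Ω} (hμ : ∀ ω, 0 < μ₀ ω)
    {e : UtilityPair A Ω}
    (huniq : ∀ (p q : MessagingStrategy Ω M × ActionStrategy M A),
      IsOptimal μ₀ e p → IsOptimal μ₀ e q → ∀ ω a, outcome μ₀ p ω a = outcome μ₀ q ω a)
    (hS : ∀ ω a b, a ≠ b → e.1 ω a ≠ e.1 ω b)
    (hR : ∀ (f : Ω → A) (ω : Ω) (b c : A), b ≠ c →
      cellValue μ₀ e.2 f (f ω) b ≠ cellValue μ₀ e.2 f (f ω) c)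
    (hfav : ∀ b, ∃ ω, (∀ c, c ≠ b → e.1 ω c < e.1 ω b) ∧ ∀ c, c ≠ b → e.2 ω c < e.2 ω b)
    (hno : CommitmentHasNoValue M μ₀ e) :
    ∃ f : Ω → A, Function.Surjective f ∧ (∀ ω c, c ≠ f ω → e.1 ω c < e.1 ω (f ω)) ∧
      ∀ a c, c ≠ a → cellValue μ₀ e.2 f a c < cellValue μ₀ e.2 f a a := by
  classical
  have : Nonempty M := Fintype.card_pos_iff.1 (Fintype.card_pos.trans_le hM)
  obtain ⟨σ, ρ, ⟨hsbr, hrbr⟩, hval⟩ := (commitmentHasNoValue_iff μ₀ e).1 hno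
  have hopt : IsOptimal μ₀ e (σ, ρ) :=
    ⟨hrbr, fun q hq => (payoff_le_persuasionPayoff hq).trans hval⟩
  have hpos : ∀ m, ∃ a, 0 < ρ m a := fun m => exists_pos_of_stdSimplex _
  -- After a message that is sent in some state, `α m` is the only action played; after other
  -- messages it is merely one action in the support.
  choose α hα using hpos
  have hpure : ∀ ω m, 0 < σ ω m → ∀ a, 0 < ρ m a → a = α m := fun ω m hm a ha =>
    action_unique_of_isOptimal hμ huniq hopt hm ha (hα m)
  have hvalue : ∀ ω m, 0 < σ ω m → ∀ w : A → ℝ, ∑ a, ρ m a * w a = w (α m) := by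
    intro ω m hm w
    exact sum_mul_eq_of_support _ _ _ fun a ha => by rw [hpure ω m hm a ha]
  have hsbr' := (senderBR_iff μ₀ hμ e σ ρ).1 hsbr
  have hrbr' := (receiverBR_iff μ₀ e σ ρ).1 hrbr
  have hposσ : ∀ ω, ∃ m, 0 < σ ω m := fun ω => exists_pos_of_stdSimplex _
  choose μm hμm using hposσ
  let f : Ω → A := fun ω => α (μm ω)
  -- The message `m'` must be sent somewhere, since replies are known to be pure only then.
  have hbest : ∀ ω m ω' m', 0 < σ ω m → 0 < σ ω' m' → e.1 ω (α m') ≤ e.1 ω (α m) := by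
    intro ω m ω' m' hm hm'
    have h := hsbr' ω m hm m'
    rwa [hvalue ω m hm, hvalue ω' m' hm'] at h
  have hf : ∀ ω m, 0 < σ ω m → α m = f ω := by
    intro ω m hm
    by_contra hne
    exact hS ω _ _ hne (le_antisymm (hbest ω _ ω m (hμm ω) hm) (hbest ω m ω _ hm (hμm ω)))
  -- Pooling all messages that induce `a` gives the cell of `a` under `f`; hence Receiver's
  -- conditions after single messages add up to obedience to `f`.
  have hcell : ∀ (r : Utility A Ω) a c, cellValue μ₀ r f a c =
      ∑ m, if α m = a then messageValue μ₀ r σ m c else 0 := by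
    intro r a c
    rw [cellValue_eq]
    have : ∀ m, (if α m = a then messageValue μ₀ r σ m c else 0) =
        ∑ ω, if f ω = a then μ₀ ω * σ ω m * r ω c else 0 := by
      intro m
      by_cases hex : ∃ ω, 0 < σ ω m
      · by_cases hma : α m = a
        · rw [if_pos hma]
          refine Finset.sum_congr rfl fun ω _ => ?_
          rcases (stdSimplex.zero_le (σ ω) m).eq_or_lt with h0 | h0
          · rw [← h0]; simp
          · rw [if_pos ((hf ω m h0).symm.trans hma)]
        · rw [if_neg hma]
          refine (Finset.sum_eq_zero fun ω _ => ?_).symm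
          rcases (stdSimplex.zero_le (σ ω) m).eq_or_lt with h0 | h0
          · rw [← h0]; simp
          · rw [if_neg fun h => hma ((hf ω m h0).trans h)]
      · push Not at hex
        have h0 : ∀ ω, σ ω m = 0 := fun ω => le_antisymm (hex ω) (stdSimplex.zero_le _ _)
        simp [messageValue, h0]
    simp only [this]
    rw [Finset.sum_comm]
    refine Finset.sum_congr rfl fun ω _ => ?_
    split_ifs
    · rw [← Finset.sum_mul, ← Finset.mul_sum, stdSimplex.sum_eq_one, mul_one]
    · simp
  have hobed : ∀ a c, cellValue μ₀ e.2 f a c ≤ cellValue μ₀ e.2 f a a := by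
    intro a c
    rw [hcell, hcell]
    refine Finset.sum_le_sum fun m _ => ?_
    split_ifs with hma
    · rw [← hma]
      exact hrbr' m _ (hα m) c
    · exact le_rfl
  have hstrict : ∀ ω c, c ≠ f ω →
      cellValue μ₀ e.2 f (f ω) c < cellValue μ₀ e.2 f (f ω) (f ω) := fun ω c hc =>
    lt_of_le_of_ne (hobed _ _) (hR f ω _ _ hc)
  have hpay : expectedPayoff μ₀ e.1 σ ρ = ∑ ω, μ₀ ω * e.1 ω (f ω) := by
    rw [expectedPayoff_eq_sum_state]
    refine Finset.sum_congr rfl fun ω _ => sum_mul_eq_of_support _ _ _ fun m hm => ?_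
    rw [hvalue ω m hm, hf ω m hm]
  have hsurj : Function.Surjective f := by
    intro b
    by_contra hb
    obtain ⟨ω₀, hb1, hb2⟩ := hfav b
    have hb2' : ∀ c, e.2 ω₀ c ≤ e.2 ω₀ b := fun c => by
      by_cases hc : c = b
      · rw [hc]
      · exact (hb2 c hc).le
    obtain ⟨ε, h0, h1, hε, hob⟩ := exists_perturbedRule_obedient hstrict hb hb2'
    obtain ⟨σ', ρ', hbr, hp⟩ := exists_profile_of_obedient (M := M) hM μ₀ e _ hob
    have hle := hopt.2 (σ', ρ') hbr
    rw [hp, hpay] at hle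
    refine absurd hle (not_le.2 (Finset.sum_lt_sum (fun ω _ => ?_) ⟨ω₀, Finset.mem_univ _, ?_⟩))
    · refine mul_le_mul_of_nonneg_left ?_ (hμ ω).le
      simp only [perturbedRule_apply, add_mul, Finset.sum_add_distrib, sum_dirac_mul]
      rw [le_add_iff_nonneg_right]
      by_cases hω : ω = ω₀
      · subst hω
        simp only [if_true, mul_assoc, sub_mul, ← Finset.mul_sum, Finset.sum_sub_distrib,
          sum_dirac_mul]
        exact mul_nonneg h0 (sub_nonneg.2 (hb1 _ fun h => hb ⟨ω, h⟩).le)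
      · simp [hω]
    · refine mul_lt_mul_of_pos_left ?_ (hμ ω₀)
      simp only [perturbedRule_apply, add_mul, Finset.sum_add_distrib, sum_dirac_mul]
      rw [lt_add_iff_pos_right]
      simp only [if_true, mul_assoc, sub_mul, ← Finset.mul_sum, Finset.sum_sub_distrib,
        sum_dirac_mul]
      exact mul_pos hε (sub_pos.2 (hb1 _ fun h => hb ⟨ω₀, h⟩))
  refine ⟨f, hsurj, fun ω c hc => ?_, fun a c hc => ?_⟩
  · obtain ⟨ω', rfl⟩ := hsurj c
    -- Surjectivity turns "best among the induced actions" into "best among all actions".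
    exact lt_of_le_of_ne (hbest ω _ ω' _ (hμm ω) (hμm ω')) (hS ω _ _ hc)
  · obtain ⟨ω, rfl⟩ := hsurj a
    exact hstrict ω c hc

end

/-! ### Volumes of favourite and reply sets. -/

section

variable {A : Type u} [Fintype A] {Ω : Type v} [Fintype Ω]

/-- The set of utility functions with values in `[0, 1]`. -/
def cube (A : Type u) (Ω : Type v) : Set (Utility A Ω) :=
  Set.univ.pi fun _ => Set.univ.pi fun _ => Set.Icc (0 : ℝ) 1

theorem mem_cube {r : Utility A Ω} : r ∈ cube A Ω ↔ ∀ ω a, r ω a ∈ Set.Icc (0 : ℝ) 1 := by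
  simp only [cube, Set.mem_pi, Set.mem_univ, forall_const]

theorem environments_eq_prod : environments A Ω = cube A Ω ×ˢ cube A Ω := by
  ext e
  simp only [environments, Set.mem_ofPred_eq, Set.mem_prod, mem_cube, forall_and]

theorem volume_cube : volume (cube A Ω) = 1 := by
  unfold cube
  rw [volume_pi_pi]
  refine Finset.prod_eq_one fun ω _ => ?_
  rw [volume_pi_pi]
  simp

theorem measurableSet_cube : MeasurableSet (cube A Ω) :=
  MeasurableSet.univ_pi fun _ => MeasurableSet.univ_pi fun _ => measurableSet_Icc

theorem volume_environments : volume (environments A Ω) = 1 := by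
  rw [environments_eq_prod, Measure.volume_eq_prod, Measure.prod_prod, volume_cube, one_mul]

theorem measurable_cellValue (μ₀ : stdSimplex ℝ Ω) (f : Ω → A) (a c : A) :
    Measurable fun r : Utility A Ω => cellValue μ₀ r f a c := by
  classical
  simp only [cellValue_eq]
  refine Finset.measurable_fun_sum _ fun ω _ => ?_
  split_ifs <;> fun_prop

/-- Receiver's utility functions under which, after a recommendation `a` made by `f`, the action
`g a` is optimal. -/
def optimalReplySet (μ₀ : stdSimplex ℝ Ω) (f : Ω → A) (g : A → A) : Set (Utility A Ω) :=
  {r | r ∈ cube A Ω ∧ ∀ a c, cellValue μ₀ r f a c ≤ cellValue μ₀ r f a (g a)}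

/-- Receiver's utility functions under which, after a recommendation `a` made by `f`, the action
`g a` is uniquely optimal. -/
def strictReplySet (μ₀ : stdSimplex ℝ Ω) (f : Ω → A) (g : A → A) : Set (Utility A Ω) :=
  {r | r ∈ cube A Ω ∧ ∀ a c, c ≠ g a → cellValue μ₀ r f a c < cellValue μ₀ r f a (g a)}

theorem measurableSet_optimalReplySet (μ₀ : stdSimplex ℝ Ω) (f : Ω → A) (g : A → A) :
    MeasurableSet (optimalReplySet μ₀ f g) := by
  have h : optimalReplySet μ₀ f g = cube A Ω ∩ ⋂ a, ⋂ c,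
      {r | cellValue μ₀ r f a c ≤ cellValue μ₀ r f a (g a)} := by
    ext r
    simp [optimalReplySet]
  rw [h]
  exact measurableSet_cube.inter (MeasurableSet.iInter fun a => MeasurableSet.iInter fun c =>
    measurableSet_le (measurable_cellValue μ₀ f a c) (measurable_cellValue μ₀ f a (g a)))

theorem measurableSet_strictReplySet (μ₀ : stdSimplex ℝ Ω) (f : Ω → A) (g : A → A) :
    MeasurableSet (strictReplySet μ₀ f g) := by
  have h : strictReplySet μ₀ f g = cube A Ω ∩ ⋂ a, ⋂ c, ⋂ _ : c ≠ g a,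
      {r | cellValue μ₀ r f a c < cellValue μ₀ r f a (g a)} := by
    ext r
    simp [strictReplySet]
  rw [h]
  exact measurableSet_cube.inter (MeasurableSet.iInter fun a => MeasurableSet.iInter fun c =>
    MeasurableSet.iInter fun _ =>
      measurableSet_lt (measurable_cellValue μ₀ f a c) (measurable_cellValue μ₀ f a (g a)))

/-- Relabel the actions by `π ω` in each state `ω`. -/
def relabel (π : Ω → Equiv.Perm A) (r : Utility A Ω) : Utility A Ω := fun ω a => r ω (π ω a)

theorem measurePreserving_relabel (π : Ω → Equiv.Perm A) :
    MeasurePreserving (relabel π) (volume : Measure (Utility A Ω)) volume := by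
  refine volume_preserving_pi (f := fun ω (s : A → ℝ) a => s (π ω a)) fun ω => ?_
  convert volume_measurePreserving_piCongrLeft (fun _ : A => ℝ) (π ω).symm using 1
  ext s a
  simp [MeasurableEquiv.piCongrLeft, Equiv.piCongrLeft_apply]

theorem relabel_mem_cube (π : Ω → Equiv.Perm A) (r : Utility A Ω) :
    relabel π r ∈ cube A Ω ↔ r ∈ cube A Ω := by
  rw [mem_cube, mem_cube]
  exact forall_congr' fun ω =>
    ((π ω).surjective.forall (p := fun a => r ω a ∈ Set.Icc (0 : ℝ) 1)).symm

/-- Only states in the cell of `a` enter, so the permutations chosen for different cells do not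
interfere. -/
theorem cellValue_relabel (μ₀ : stdSimplex ℝ Ω) (π : A → Equiv.Perm A) (r : Utility A Ω)
    (f : Ω → A) (a c : A) :
    cellValue μ₀ (relabel (fun ω => π (f ω)) r) f a c = cellValue μ₀ r f a (π a c) := by
  classical
  rw [cellValue_eq, cellValue_eq]
  refine Finset.sum_congr rfl fun ω _ => ?_
  split_ifs with h
  · simp [relabel, h]
  · rfl

/-- In the cell of `a`, swap the labels `a` and `g a`. One swap per cell works even when `g` is not
injective. -/
theorem volume_optimalReplySet_eq (μ₀ : stdSimplex ℝ Ω) (f : Ω → A) (g : A → A) :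
    volume (optimalReplySet μ₀ f g) = volume (optimalReplySet μ₀ f id) := by
  classical
  rw [← (measurePreserving_relabel fun ω => Equiv.swap (f ω) (g (f ω))).measure_preimage
    (measurableSet_optimalReplySet μ₀ f id).nullMeasurableSet]
  congr 1
  ext r
  simp only [optimalReplySet, Set.mem_preimage, Set.mem_ofPred_eq, relabel_mem_cube, id_eq,
    cellValue_relabel μ₀ (fun a => Equiv.swap a (g a)), Equiv.swap_apply_left]
  refine and_congr_right fun _ => forall_congr' fun a => ?_
  refine ⟨fun h c => h _, fun h c => ?_⟩
  have := h (Equiv.swap a (g a) c)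
  rwa [Equiv.swap_apply_self] at this

theorem volume_strictReplySet_eq (μ₀ : stdSimplex ℝ Ω) (f : Ω → A) (g : A → A) :
    volume (strictReplySet μ₀ f g) = volume (strictReplySet μ₀ f id) := by
  classical
  rw [← (measurePreserving_relabel fun ω => Equiv.swap (f ω) (g (f ω))).measure_preimage
    (measurableSet_strictReplySet μ₀ f id).nullMeasurableSet]
  congr 1
  ext r
  simp only [strictReplySet, Set.mem_preimage, Set.mem_ofPred_eq, relabel_mem_cube, id_eq,
    cellValue_relabel μ₀ (fun a => Equiv.swap a (g a)), Equiv.swap_apply_left]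
  refine and_congr_right fun _ => forall_congr' fun a => ?_
  refine ⟨fun h c hc => h _ ?_, fun h c hc => ?_⟩
  · rw [Ne, Equiv.swap_apply_eq_iff, Equiv.swap_apply_right]
    exact hc
  · have := h (Equiv.swap a (g a) c) ?_
    · rwa [Equiv.swap_apply_self] at this
    · rw [Ne, Equiv.swap_apply_eq_iff, Equiv.swap_apply_left]
      exact hc

/-- A best reply to each recommendation always exists, so the equal-volume sets indexed by `g` cover
the cube. -/
theorem one_le_card_mul_volume_optimalReplySet [Nonempty A] (μ₀ : stdSimplex ℝ Ω) (f : Ω → A) :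
    1 ≤ (Fintype.card A : ENNReal) ^ Fintype.card A * volume (optimalReplySet μ₀ f id) := by
  classical
  have hcover : cube A Ω ⊆ ⋃ g : A → A, optimalReplySet μ₀ f g := by
    intro r hr
    choose g hg using fun a => Finite.exists_max (cellValue μ₀ r f a)
    exact Set.mem_iUnion.2 ⟨g, hr, hg⟩
  calc 1 = volume (cube A Ω) := volume_cube.symm
    _ ≤ ∑ g : A → A, volume (optimalReplySet μ₀ f g) :=
        (measure_mono hcover).trans (measure_iUnion_fintype_le _ _)
    _ = _ := by
        simp only [volume_optimalReplySet_eq]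
        simp

/-- A strictly best reply is unique, so the equal-volume sets are disjoint. If some cell is empty
and there are at least two actions, these sets are empty, and the bound still holds. -/
theorem card_mul_volume_strictReplySet_le_one (μ₀ : stdSimplex ℝ Ω) (f : Ω → A) :
    (Fintype.card A : ENNReal) ^ Fintype.card A * volume (strictReplySet μ₀ f id) ≤ 1 := by
  classical
  have hdis : Pairwise (Function.onFun Disjoint (strictReplySet μ₀ f)) := by
    intro g g' hne
    refine Set.disjoint_left.2 fun r hr hr' => ?_
    obtain ⟨a, ha⟩ := Function.ne_iff.1 hne
    exact lt_asymm (hr.2 a _ (Ne.symm ha)) (hr'.2 a _ ha)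
  calc (Fintype.card A : ENNReal) ^ Fintype.card A * volume (strictReplySet μ₀ f id)
      = ∑ g : A → A, volume (strictReplySet μ₀ f g) := by
        simp only [volume_strictReplySet_eq]
        simp
    _ = volume (⋃ g : A → A, strictReplySet μ₀ f g) := by
        rw [measure_iUnion hdis fun g => measurableSet_strictReplySet μ₀ f g, tsum_fintype]
    _ ≤ volume (cube A Ω) := measure_mono (Set.iUnion_subset fun g r hr => hr.1)
    _ = 1 := volume_cube

/-- Sender's utility functions for which `f ω` is the unique favourite action in each state `ω`. -/
def favouriteSet (f : Ω → A) : Set (Utility A Ω) :=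
  {s | s ∈ cube A Ω ∧ ∀ ω c, c ≠ f ω → s ω c < s ω (f ω)}

theorem measurableSet_favouriteSet (f : Ω → A) : MeasurableSet (favouriteSet f) := by
  have h : favouriteSet f = cube A Ω ∩ ⋂ ω, ⋂ c, ⋂ _ : c ≠ f ω,
      {s | s ω c < s ω (f ω)} := by
    ext s
    simp [favouriteSet]
  rw [h]
  exact measurableSet_cube.inter (MeasurableSet.iInter fun ω => MeasurableSet.iInter fun c =>
    MeasurableSet.iInter fun _ => measurableSet_lt (by fun_prop) (by fun_prop))

theorem disjoint_favouriteSet :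
    Pairwise (Function.onFun Disjoint (favouriteSet : (Ω → A) → Set (Utility A Ω))) := by
  intro f f' hne
  refine Set.disjoint_left.2 fun r hr hr' => ?_
  obtain ⟨ω, hω⟩ := Function.ne_iff.1 hne
  exact lt_asymm (hr.2 ω _ (Ne.symm hω)) (hr'.2 ω _ hω)

theorem sum_volume_favouriteSet [Nonempty A] [DecidableEq Ω] :
    ∑ f : Ω → A, volume (favouriteSet f) = 1 := by
  refine le_antisymm ?_ ?_
  · calc ∑ f : Ω → A, volume (favouriteSet f) = volume (⋃ f : Ω → A, favouriteSet f) := by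
          rw [measure_iUnion disjoint_favouriteSet measurableSet_favouriteSet, tsum_fintype]
      _ ≤ volume (cube A Ω) := measure_mono (Set.iUnion_subset fun f r hr => hr.1)
      _ = 1 := volume_cube
  -- Absence of ties is known for almost all pairs, so Receiver's cube is carried along as a factor
  -- of volume one.
  · have hae : environments A Ω ≤ᵐ[volume] ⋃ f : Ω → A, favouriteSet f ×ˢ cube A Ω := by
      filter_upwards [ae_sender_strict (A := A) (Ω := Ω)] with e hS he
      rw [environments_eq_prod] at he
      choose f hf using fun ω => Finite.exists_max (e.1 ω)
      exact Set.mem_iUnion.2 ⟨f, ⟨he.1, fun ω c hc => lt_of_le_of_ne (hf ω c) (hS ω _ _ hc)⟩,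
        he.2⟩
    calc 1 = volume (environments A Ω) := volume_environments.symm
      _ ≤ volume (⋃ f : Ω → A, favouriteSet f ×ˢ cube A Ω) := measure_mono_ae hae
      _ ≤ ∑ f : Ω → A, volume (favouriteSet f ×ˢ cube A Ω) := measure_iUnion_fintype_le _ _
      _ = ∑ f : Ω → A, volume (favouriteSet f) := by
          refine Finset.sum_congr rfl fun f _ => ?_
          rw [Measure.volume_eq_prod, Measure.prod_prod, volume_cube, mul_one]

/-! ### States with a common favourite. -/

/-- Utilities in a single state for which `b` is better than `1 / 2` and all other actions are
worse. -/
def topBox (b : A) : Set (A → ℝ) := by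
  classical
  exact Set.univ.pi fun a => if a = b then Set.Ioc (1 / 2) 1 else Set.Ico 0 (1 / 2)

theorem topBox_subset (b : A) : topBox b ⊆ Set.univ.pi fun _ => Set.Icc (0 : ℝ) 1 := by
  intro s hs a _
  have h := hs a trivial
  dsimp only at h
  split_ifs at h
  · exact ⟨by linarith [h.1], h.2⟩
  · exact ⟨h.1, by linarith [h.2]⟩

theorem lt_of_mem_topBox {b c : A} {s : A → ℝ} (hs : s ∈ topBox b) (hc : c ≠ b) : s c < s b := by
  have hb := hs b trivial
  have hc' := hs c trivial
  dsimp only at hb hc'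
  rw [if_pos rfl] at hb
  rw [if_neg hc] at hc'
  exact hc'.2.trans hb.1

theorem measurableSet_topBox (b : A) : MeasurableSet (topBox b) := by
  refine MeasurableSet.univ_pi fun a => ?_
  split_ifs
  exacts [measurableSet_Ioc, measurableSet_Ico]

theorem volume_topBox_ne_zero (b : A) : volume (topBox b) ≠ 0 := by
  unfold topBox
  rw [volume_pi_pi, Finset.prod_ne_zero_iff]
  intro a _
  split_ifs <;> norm_num

/-- Pairs of utilities in a single state that are not both in the box `topBox b`. -/
def missBox (b : A) : Set ((A → ℝ) × (A → ℝ)) :=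
  ((Set.univ.pi fun _ => Set.Icc (0 : ℝ) 1) ×ˢ (Set.univ.pi fun _ => Set.Icc (0 : ℝ) 1)) \
    (topBox b ×ˢ topBox b)

theorem volume_missBox_lt_one (b : A) : volume (missBox b) < 1 := by
  have hC : volume ((Set.univ.pi fun _ : A => Set.Icc (0 : ℝ) 1) ×ˢ
      (Set.univ.pi fun _ : A => Set.Icc (0 : ℝ) 1)) = 1 := by
    rw [Measure.volume_eq_prod, Measure.prod_prod, volume_pi_pi]
    simp
  have hQ : volume (topBox b ×ˢ topBox b) ≠ 0 := by
    rw [Measure.volume_eq_prod, Measure.prod_prod]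
    exact mul_ne_zero (volume_topBox_ne_zero b) (volume_topBox_ne_zero b)
  have hsub := Set.prod_mono (topBox_subset b) (topBox_subset b)
  have hfin : volume (topBox b ×ˢ topBox b) ≠ ⊤ :=
    ((measure_mono hsub).trans_lt (hC ▸ ENNReal.one_lt_top)).ne
  unfold missBox
  rw [measure_sdiff hsub ((measurableSet_topBox b).prod (measurableSet_topBox b)).nullMeasurableSet
    hfin, hC]
  exact ENNReal.sub_lt_self ENNReal.one_ne_top one_ne_zero hQ

/-- Environments in which some action is in no state the unique favourite of both players. -/
def noCommonFavourite (A : Type u) (Ω : Type v) : Set (UtilityPair A Ω) :=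
  {e | e ∈ environments A Ω ∧ ¬ ∀ b, ∃ ω,
    (∀ c, c ≠ b → e.1 ω c < e.1 ω b) ∧ ∀ c, c ≠ b → e.2 ω c < e.2 ω b}

/-- States are independent: regrouping a pair of utility functions as one pair per state makes the
event for each `b` lie in a product over states. A union bound over `b` finishes. -/
theorem volume_noCommonFavourite_le :
    volume (noCommonFavourite A Ω) ≤ ∑ b : A, volume (missBox b) ^ Fintype.card Ω := by
  have hmp := (volume_measurePreserving_arrowProdEquivProdArrow (A → ℝ) (A → ℝ) Ω).symm
  have hsub : noCommonFavourite A Ω ⊆ ⋃ b : A,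
      (MeasurableEquiv.arrowProdEquivProdArrow (A → ℝ) (A → ℝ) Ω).symm ⁻¹'
        Set.univ.pi fun _ => missBox b := by
    rintro e ⟨he, hno⟩
    push Not at hno
    obtain ⟨b, hb⟩ := hno
    refine Set.mem_iUnion.2 ⟨b, fun ω _ => ⟨⟨fun a _ => (he ω a).1, fun a _ => (he ω a).2⟩, ?_⟩⟩
    rintro ⟨h1, h2⟩
    obtain ⟨c, hc, hlt⟩ := hb ω fun c hc => lt_of_mem_topBox h1 hc
    exact absurd (lt_of_mem_topBox h2 hc) (not_lt.2 hlt)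
  refine (measure_mono hsub).trans ((measure_iUnion_fintype_le _ _).trans
    (Finset.sum_le_sum fun b _ => ?_))
  rw [hmp.measure_preimage_equiv, volume_pi_pi]
  simp

theorem tendsto_sum_volume_missBox_pow (A : Type u) [Fintype A] :
    Filter.Tendsto (fun n : ℕ => ∑ b : A, volume (missBox b) ^ n) Filter.atTop (nhds 0) := by
  have h : Filter.Tendsto (fun n : ℕ => ∑ b : A, volume (missBox b) ^ n) Filter.atTop
      (nhds (∑ _b : A, 0)) := tendsto_finsetSum _ fun b _ =>
    ENNReal.tendsto_pow_atTop_nhds_zero_of_lt_one (volume_missBox_lt_one b)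
  simpa using h

/-! ### Bounds on the volume of environments without commitment value. -/

section

variable {M : Type w} [Fintype M]

theorem measurableSet_environments_commitmentHasNoValue [Nonempty A] [Nonempty M]
    (μ₀ : stdSimplex ℝ Ω) :
    MeasurableSet {e : UtilityPair A Ω | e ∈ environments A Ω ∧ CommitmentHasNoValue M μ₀ e} :=
  measurableSet_environments.inter (measurableSet_commitmentHasNoValue μ₀)

/-- Slice by Sender's favourite rule `f`: whatever `f` is, Receiver obeys it on a set of at least
the required volume, and the weights of the slices sum to one. -/
theorem inv_card_pow_le_volume [Nonempty A] (hM : Fintype.card A ≤ Fintype.card M)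
    (μ₀ : stdSimplex ℝ Ω) :
    ((Fintype.card A : ENNReal) ^ Fintype.card A)⁻¹ ≤
      volume {e : UtilityPair A Ω | e ∈ environments A Ω ∧ CommitmentHasNoValue M μ₀ e} := by
  classical
  have hsub : (⋃ f : Ω → A, favouriteSet f ×ˢ optimalReplySet μ₀ f id) ⊆
      {e : UtilityPair A Ω | e ∈ environments A Ω ∧ CommitmentHasNoValue M μ₀ e} := by
    refine Set.iUnion_subset fun f e he => ⟨?_, ?_⟩
    · rw [environments_eq_prod]
      exact ⟨he.1.1, he.2.1⟩
    · refine commitmentHasNoValue_of_obedient hM μ₀ e f (fun ω c => ?_) he.2.2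
      by_cases hc : c = f ω
      · rw [hc]
      · exact (he.1.2 ω c hc).le
  refine le_trans ?_ (measure_mono hsub)
  rw [measure_iUnion (fun f f' hne => Set.disjoint_prod.2 (Or.inl (disjoint_favouriteSet hne)))
    fun f => (measurableSet_favouriteSet f).prod (measurableSet_optimalReplySet μ₀ f id),
    tsum_fintype]
  calc ((Fintype.card A : ENNReal) ^ Fintype.card A)⁻¹
      = ∑ f : Ω → A, volume (favouriteSet f) * ((Fintype.card A : ENNReal) ^ Fintype.card A)⁻¹ := by
        rw [← Finset.sum_mul, sum_volume_favouriteSet, one_mul]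
    _ ≤ ∑ f : Ω → A, volume (favouriteSet f ×ˢ optimalReplySet μ₀ f id) := by
        refine Finset.sum_le_sum fun f _ => ?_
        rw [Measure.volume_eq_prod, Measure.prod_prod]
        gcongr
        rw [ENNReal.inv_le_iff_le_mul]
        · exact one_le_card_mul_volume_optimalReplySet μ₀ f
        · simp
        · simp

/-- Up to a null set, either Receiver strictly obeys Sender's favourite rule or some action lacks a
common-favourite state; the second case is the error term. -/
theorem volume_commitmentHasNoValue_le [Nonempty A] (hM : Fintype.card A ≤ Fintype.card M)
    (μ₀ : stdSimplex ℝ Ω) (hμ : ∀ ω, 0 < μ₀ ω) :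
    volume {e : UtilityPair A Ω | e ∈ environments A Ω ∧ CommitmentHasNoValue M μ₀ e} ≤
      ((Fintype.card A : ENNReal) ^ Fintype.card A)⁻¹ +
        ∑ b : A, volume (missBox b) ^ Fintype.card Ω := by
  classical
  have : Nonempty M := Fintype.card_pos_iff.1 (Fintype.card_pos.trans_le hM)
  have hae : {e : UtilityPair A Ω | e ∈ environments A Ω ∧ CommitmentHasNoValue M μ₀ e} ≤ᵐ[volume]
      ((⋃ f : Ω → A, favouriteSet f ×ˢ strictReplySet μ₀ f id) ∪ noCommonFavourite A Ω :
        Set (UtilityPair A Ω)) := by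
    filter_upwards [ae_outcome_eq_of_isOptimal (M := M) μ₀, ae_sender_strict,
      ae_receiver_strict μ₀ hμ] with e huniq hS hR he
    by_cases hfav : ∀ b, ∃ ω,
        (∀ c, c ≠ b → e.1 ω c < e.1 ω b) ∧ ∀ c, c ≠ b → e.2 ω c < e.2 ω b
    · left
      obtain ⟨f, -, hf1, hf2⟩ :=
        exists_favourite_of_commitmentHasNoValue hM hμ huniq hS hR hfav he.2
      have hen := he.1
      rw [environments_eq_prod] at hen
      exact Set.mem_iUnion.2 ⟨f, ⟨hen.1, hf1⟩, hen.2, hf2⟩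
    · exact Or.inr ⟨he.1, hfav⟩
  refine (measure_mono_ae hae).trans ((measure_union_le _ _).trans
    (add_le_add ?_ volume_noCommonFavourite_le))
  calc volume (⋃ f : Ω → A, favouriteSet f ×ˢ strictReplySet μ₀ f id)
      ≤ ∑ f : Ω → A, volume (favouriteSet f ×ˢ strictReplySet μ₀ f id) :=
        measure_iUnion_fintype_le _ _
    _ ≤ ∑ f : Ω → A, volume (favouriteSet f) * ((Fintype.card A : ENNReal) ^ Fintype.card A)⁻¹ := by
        refine Finset.sum_le_sum fun f _ => ?_
        rw [Measure.volume_eq_prod, Measure.prod_prod]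
        gcongr
        rw [ENNReal.le_inv_iff_mul_le, mul_comm]
        exact card_mul_volume_strictReplySet_le_one μ₀ f
    _ = ((Fintype.card A : ENNReal) ^ Fintype.card A)⁻¹ := by
        rw [← Finset.sum_mul, sum_volume_favouriteSet, one_mul]

end

end

end Commitment

end

theorem theorem3 (A : Type u) [Fintype A] [Nonempty A] :
    (∀ (Ω : Type v) [Fintype Ω] (M : Type w) [Fintype M] (μ₀ : stdSimplex ℝ Ω),
      (∀ ω, 0 < μ₀ ω) →
      max (Fintype.card Ω) (Fintype.card A) < Fintype.card M →
        MeasurableSet {e : Commitment.UtilityPair A Ω |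
          e ∈ Commitment.environments A Ω ∧ Commitment.CommitmentHasNoValue M μ₀ e} ∧
        1 / (Fintype.card A : ℝ) ^ Fintype.card A ≤
          Commitment.share (A := A) (Ω := Ω) (Commitment.CommitmentHasNoValue M μ₀)) ∧
    (∀ ε : ℝ, 0 < ε → ∃ N : ℕ,
      ∀ (Ω : Type v) [Fintype Ω] (M : Type w) [Fintype M] (μ₀ : stdSimplex ℝ Ω),
        (∀ ω, 0 < μ₀ ω) →
        max (Fintype.card Ω) (Fintype.card A) < Fintype.card M →
        N ≤ Fintype.card Ω →
          |Commitment.share (A := A) (Ω := Ω) (Commitment.CommitmentHasNoValue M μ₀) -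
            1 / (Fintype.card A : ℝ) ^ Fintype.card A| < ε) := by
  have hinv : (((Fintype.card A : ENNReal) ^ Fintype.card A)⁻¹).toReal =
      1 / (Fintype.card A : ℝ) ^ Fintype.card A := by
    simp
  have hfin : ((Fintype.card A : ENNReal) ^ Fintype.card A)⁻¹ ≠ ⊤ := by simp
  have hlower : ∀ (Ω : Type v) [Fintype Ω] (M : Type w) [Fintype M] (μ₀ : stdSimplex ℝ Ω),
      max (Fintype.card Ω) (Fintype.card A) < Fintype.card M →
        1 / (Fintype.card A : ℝ) ^ Fintype.card A ≤
          Commitment.share (A := A) (Ω := Ω) (Commitment.CommitmentHasNoValue M μ₀) := by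
    intro Ω _ M _ μ₀ hM
    rw [← hinv]
    refine ENNReal.toReal_mono (ne_top_of_le_ne_top ENNReal.one_ne_top ?_)
      (Commitment.inv_card_pow_le_volume ((le_max_right _ _).trans hM.le) μ₀)
    exact (measure_mono fun e he => he.1).trans Commitment.volume_environments.le
  refine ⟨fun Ω _ M _ μ₀ hμ hM => ⟨?_, hlower Ω M μ₀ hM⟩, fun ε hε => ?_⟩
  · have : Nonempty M := Fintype.card_pos_iff.1 ((Nat.zero_le _).trans_lt hM)
    exact Commitment.measurableSet_environments_commitmentHasNoValue μ₀
  -- The error term involves only `A` and the number of states, so `N` is fixed before the state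
  -- space, prior and messages.
  · obtain ⟨N, hN⟩ := Filter.eventually_atTop.1
      ((Commitment.tendsto_sum_volume_missBox_pow A).eventually_lt_const
        (ENNReal.ofReal_pos.2 hε))
    refine ⟨N, fun Ω _ M _ μ₀ hμ hM hΩ => ?_⟩
    have hlow := hlower Ω M μ₀ hM
    have hbad := hN _ hΩ
    have hup := Commitment.volume_commitmentHasNoValue_le
      ((le_max_right _ _).trans hM.le) μ₀ hμ
    have hreal := ENNReal.toReal_mono (ENNReal.add_ne_top.2 ⟨hfin, hbad.ne_top⟩) hup
    rw [ENNReal.toReal_add hfin hbad.ne_top, hinv] at hreal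
    have hlt := (ENNReal.lt_ofReal_iff_toReal_lt hbad.ne_top).1 hbad
    unfold Commitment.share at hlow ⊢
    rw [abs_lt]
    constructor <;> linarith
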